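/- Let a group $\Gamma$ act faithfully on a set $X$. A coloring $c$ of $X$ is $\Gamma$-distinguishing if the only $\gamma\in\Gamma$ with $c\circ\gamma=c$ is the identity, and the distinguishing number $k=D_\Gamma(X)$ is the smallest $k$ for which $X$ has a $\Gamma$-distinguishing coloring $X\to\{1,\dots,k\}$. For $W\subseteq X$, say that $P(W)$ holds if every precoloring $c\colon X\setminus W\to\{1,\dots,k\}$ with $k=D_\Gamma(X)$ extends to a $\Gamma$-distinguishing coloring $X\to\{1,\dots,k\}$. The distinguishing extension number $\mathrm{ext}_D(X,\Gamma)\in\mathbb{N}\cup\{\infty\}$ is the smallest natural number $n$ such that $P(W)$ holds for every (finite or infinite) $W\subseteq X$ with $|W|\ge n$ that is not pointwise fixed by any nontrivial element of $\Gamma$ (and $\infty$ if there is no such $n$). Theorem 3. Let $O(2)$ act on $\mathbb{R}^2$ by the maps $v\mapsto Av$ with $A$ an orthogonal $2\times 2$ matrix, and let $SE(2)$ be the group of the maps $v\mapsto Av+b$ of $\mathbb{R}^2$ with $A\in SO(2)$ and $b\in\mathbb{R}^2$. Then $$\mathrm{ext}_D(\mathbb{R}^2,O(2))=7\qquad\text{and}\qquad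 \mathrm{ext}_D(\mathbb{R}^2,SE(2))<\infty.$$ -/

import Mathlib

open scoped Matrix

/-- A coloring `c` is `Γ`-distinguishing if the identity is the only element of `Γ`
that preserves it. -/
def IsDistinguishing (Γ : Type*) {X κ : Type*} [Group Γ] [MulAction Γ X] (c : X → κ) : Prop :=
  ∀ γ : Γ, (∀ x : X, c (γ • x) = c x) → γ = 1

/-- The distinguishing number `D_Γ(X)`: the smallest `k` such that `X` has a `Γ`-distinguishing
`k`-coloring (and `0` if there is none for any natural number `k`). -/
noncomputable def distinguishingNumber (Γ X : Type*) [Group Γ] [MulAction Γ X] : ℕ :=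
  sInf {k : ℕ | ∃ c : X → Fin k, IsDistinguishing Γ c}

/-- The precoloring extension property `P(W)`: every precoloring of the complement of `W` with
`k = D_Γ(X)` colors extends to a `Γ`-distinguishing `k`-coloring of `X`. -/
def PrecoloringExtension (Γ : Type*) {X : Type*} [Group Γ] [MulAction Γ X] (W : Set X) : Prop :=
  ∀ c : ↥(Wᶜ) → Fin (distinguishingNumber Γ X),
    ∃ c' : X → Fin (distinguishingNumber Γ X), (∀ x : ↥(Wᶜ), c' x = c x) ∧ IsDistinguishing Γ c'

/-- The distinguishing extension number `ext_D(X, Γ)`: the smallest natural number `n` such that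
`P(W)` holds for all `W ⊆ X` (finite or infinite) with `|W| ≥ n` and trivial pointwise stabilizer;
it is `⊤` if there is no such `n`. -/
noncomputable def extNumber (X Γ : Type*) [Group Γ] [MulAction Γ X] : ℕ∞ :=
  ⨅ n ∈ {n : ℕ | ∀ W : Set X, (n : ℕ∞) ≤ W.encard → fixingSubgroup Γ W = ⊥ →
    PrecoloringExtension Γ W}, (n : ℕ∞)

/-- `O(2)`, as the group of the transformations `v ↦ A v` of the plane, `A` orthogonal. -/
def planeO2 : Subgroup (Equiv.Perm (Fin 2 → ℝ)) where
  carrier := {f | ∃ A ∈ Matrix.orthogonalGroup (Fin 2) ℝ, ∀ v, f v = A *ᵥ v}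
  one_mem' := ⟨1, one_mem _, fun v => by simp⟩
  mul_mem' := by
    rintro f g ⟨A, hA, hf⟩ ⟨B, hB, hg⟩
    exact ⟨A * B, mul_mem hA hB, fun v => by
      rw [Equiv.Perm.mul_apply, hg, hf, Matrix.mulVec_mulVec]⟩
  inv_mem' := by
    rintro f ⟨A, hA, hf⟩
    refine ⟨star A, Unitary.star_mem hA, fun v => ?_⟩
    rw [Equiv.Perm.inv_eq_iff_eq, hf, Matrix.mulVec_mulVec, Unitary.mul_star_self_of_mem hA,
      Matrix.one_mulVec]

/-- `SE(2)`, the group of the transformations `v ↦ A v + b` of the plane, with `A ∈ SO(2)` and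
`b` a vector. -/
def planeSE2 : Subgroup (Equiv.Perm (Fin 2 → ℝ)) where
  carrier := {f | ∃ A ∈ Matrix.specialOrthogonalGroup (Fin 2) ℝ, ∃ b : Fin 2 → ℝ,
    ∀ v, f v = A *ᵥ v + b}
  one_mem' := ⟨1, one_mem _, 0, fun v => by simp⟩
  mul_mem' := by
    rintro f g ⟨A, hA, a, hf⟩ ⟨B, hB, b, hg⟩
    exact ⟨A * B, mul_mem hA hB, A *ᵥ b + a, fun v => by
      rw [Equiv.Perm.mul_apply, hg, hf, Matrix.mulVec_add, Matrix.mulVec_mulVec, add_assoc]⟩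
  inv_mem' := by
    rintro f ⟨A, hA, a, hf⟩
    have h1 : A * star A = 1 := Unitary.mul_star_self_of_mem hA.1
    refine ⟨star A,
      (star (⟨A, hA⟩ : Matrix.specialOrthogonalGroup (Fin 2) ℝ)).2, -(star A *ᵥ a),
      fun v => ?_⟩
    rw [Equiv.Perm.inv_eq_iff_eq, hf, Matrix.mulVec_add, Matrix.mulVec_neg, Matrix.mulVec_mulVec,
      Matrix.mulVec_mulVec, h1, Matrix.one_mulVec, Matrix.one_mulVec]
    simp

/-! A precoloring becomes a function `f` vanishing on `W`, and an extension becomes `f + 1_S` with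
`S ⊆ W`. It suffices that, for any integer-valued `f`, some `f + 1_S` has no symmetry.

For `O(2)`, polar coordinates turn the punctured plane into `I × G`: radii times the circle group.
Rotations become translations of `G`, reflections become `x ↦ s - x` with axis `{x | x + x = s}`. If
every `f + 1_S` is symmetric, toggling an off-axis point of an aperiodic one moves the axis, and
comparing two such moves gives rigid equations (`reflection_relation`). These exclude two points
with different radii and different doubles, and six points on one circle. Seven points not fixed by
a reflection contain one of these configurations, as the origin costs one point. Sharpness comes
from a regular pentagon with its center, since each two-coloring of it has a mirror axis.

For `SE(2)`, nine points suffice. If only translations and half-turns occur as symmetries, the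
six-point result applies with `G = ℂ`. Otherwise some rotation has `a ≠ ±1`; with the symmetry after
one toggle it yields a translation preserving `f` up to finitely many points, hence two independent
ones. Then `f` is a periodic `F` plus a finitely supported function, and moments make the latter
asymmetric (`exists_asymmetric_of_finite_support`). -/

section Dihedral

/-! ### Translations and reflections of an abelian group; toggling points. -/

variable {I G : Type*} [AddCommGroup G]

/-- `f` has no nonzero period in the second coordinate. -/
def IsAperiodic (f : I × G → ℤ) : Prop := ∀ p : G, (∀ i x, f (i, x + p) = f (i, x)) → p = 0

/-- `f` is invariant under the reflection `x ↦ s - x` of the second coordinate. -/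
def IsReflectionInvariant (f : I × G → ℤ) (s : G) : Prop := ∀ i x, f (i, s - x) = f (i, x)

theorem IsAperiodic.reflection_unique {f : I × G → ℤ} (hf : IsAperiodic f) {s s' : G}
    (hs : IsReflectionInvariant f s) (hs' : IsReflectionInvariant f s') : s = s' := by
  have := hf (s' - s) fun i x => by
    rw [← hs i x, ← hs' i (s - x)]; congr 2; abel
  exact (sub_eq_zero.mp this).symm

variable [DecidableEq I] [DecidableEq G]

/-- Go around the parallelogram `x, x + p, x + q, x + p + q` with `x` at `t`, using a period `p` of
`f` and `q` of `g`. The mass `ε` enters once at `x` and perhaps again at `x + p + q`, with the same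
sign, so it cannot cancel. -/
theorem isAperiodic_or_of_add_point {f g : I × G → ℤ} {ε : ℤ} (hε : ε ≠ 0) {t : I × G}
    (hg : ∀ x, g x = f x + if x = t then ε else 0) : IsAperiodic f ∨ IsAperiodic g := by
  by_contra! h
  simp only [IsAperiodic, not_forall] at h
  obtain ⟨⟨p, hp, hp0⟩, q, hq, hq0⟩ := h
  obtain ⟨i, x⟩ := t
  have h1 := hq i x
  have h2 := hq i (x + p)
  have h3 := hp i (x + q)
  have h4 := hp i x
  rw [add_right_comm] at h3
  simp only [hg, Prod.mk.injEq, true_and, add_eq_left, hp0, hq0, if_false, if_true] at h1 h2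
  split_ifs at h2 <;> omega

theorem IsReflectionInvariant.add_point {f g : I × G → ℤ} {ε : ℤ} {t : I × G}
    (hg : ∀ x, g x = f x + if x = t then ε else 0) {s : G} (hs : IsReflectionInvariant f s)
    (ht : t.2 + t.2 = s) : IsReflectionInvariant g s := by
  intro i x
  have : ((i, s - x) = t) ↔ ((i, x) = t) := by
    obtain ⟨j, y⟩ := t
    simp only at ht
    subst ht
    simp only [Prod.mk.injEq, and_congr_right_iff]
    intro _
    constructor <;> intro h
    · rw [sub_eq_iff_eq_add] at h
      exact (add_left_cancel h).symm
    · subst h; abel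
  simp only [hg, hs i x, this]

/-- Adding a multiple of a point mass off the axis to an aperiodic reflection invariant function
does not create periods. -/
theorem IsAperiodic.add_point {f g : I × G → ℤ} {ε : ℤ} (hε : ε ≠ 0) {t : I × G}
    (hg : ∀ x, g x = f x + if x = t then ε else 0) {s : G}
    (hs : IsReflectionInvariant f s) (ht : t.2 + t.2 ≠ s) : IsAperiodic g := by
  intro r hr
  by_contra hr0
  obtain ⟨i, x⟩ := t
  have h1 := hr i x
  have h2 := hr i (s - x - r)
  have h3 := hs i x
  have h4 := hs i (x + r)
  rw [← sub_sub] at h4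
  have e : s - x ≠ x := fun h => ht (by rw [sub_eq_iff_eq_add] at h; exact h.symm)
  simp only [hg, Prod.mk.injEq, true_and, add_eq_left, hr0, if_false, if_true, sub_add_cancel,
    e] at h1 h2
  split_ifs at h2 <;> omega

/-- If `t` lay on the new axis, removing its mass would keep that symmetry; `f` would then have this
axis too, and an aperiodic function has only one. -/
theorem reflection_ne_of_add_point {f g : I × G → ℤ} {ε : ℤ} (hε : ε ≠ 0) {t : I × G}
    (hg : ∀ x, g x = f x + if x = t then ε else 0) {s s' : G} (hf : IsAperiodic f)
    (hs : IsReflectionInvariant f s) (ht : t.2 + t.2 ≠ s) (hs' : IsReflectionInvariant g s') :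
    s' ≠ s ∧ t.2 + t.2 ≠ s' := by
  constructor
  · rintro rfl
    obtain ⟨i, x⟩ := t
    have h1 := hs i x
    have h2 := hs' i x
    have e : s' - x ≠ x := fun h => ht (by rw [sub_eq_iff_eq_add] at h; exact h.symm)
    simp only [hg, Prod.mk.injEq, true_and, if_true, e, if_false] at h2
    omega
  · intro h
    have : IsReflectionInvariant f s' :=
      hs'.add_point (ε := -ε) (t := t) (fun x => by rw [hg]; split_ifs <;> simp) h
    exact ht (h.trans (hf.reflection_unique hs this).symm)

/-- The basic relation between two one-point modifications, each with a reflection symmetry, of a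
reflection invariant function. -/
theorem reflection_relation {f g h : I × G → ℤ} {ε δ : ℤ} {t u : I × G}
    (hg : ∀ x, g x = f x + if x = t then ε else 0) (hh : ∀ x, h x = f x + if x = u then δ else 0)
    {s s₁ s₂ : G} (hs : IsReflectionInvariant f s) (h₁ : IsReflectionInvariant g s₁)
    (h₂ : IsReflectionInvariant h s₂) (htu : t ≠ u) (hs₂ : s₂ ≠ s) (ht₁ : t.2 + t.2 ≠ s₁) :
    (if (t.1, t.2 - (s₁ - s)) = u then δ else 0) + ε
        + (if s₁ - t.2 + (s₂ - s) = t.2 then ε else 0)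
      = (if (t.1, s₂ + s₁ - s - t.2) = u then δ else 0)
        - (if (t.1, s₂ - t.2) = u then δ else 0) := by
  obtain ⟨i, x⟩ := t
  obtain ⟨j, y⟩ := u
  -- The reflections `s` and `s₁` compose to a translation by `s₁ - s`, along which `f` changes only
  -- through the mass at `t`.
  have key1 : ∀ k z, f (k, z - (s₁ - s)) = f (k, z) + (if (k, z) = (i, x) then ε else 0)
      - (if (k, s₁ - z) = (i, x) then ε else 0) := by
    intro k z
    have a := h₁ k z
    have b := hs k (s₁ - z)
    rw [hg, hg] at a
    rw [show s - (s₁ - z) = z - (s₁ - s) by abel] at b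
    omega
  have key2 : ∀ k z, f (k, z - (s₂ - s)) = f (k, z) + (if (k, z) = (j, y) then δ else 0)
      - (if (k, s₂ - z) = (j, y) then δ else 0) := by
    intro k z
    have a := h₂ k z
    have b := hs k (s₂ - z)
    rw [hh, hh] at a
    rw [show s - (s₂ - z) = z - (s₂ - s) by abel] at b
    omega
  -- The two translations commute: reach `x - (s₁ - s) - (s₂ - s)` from `x` by both routes and
  -- compare.
  have e1 := key1 i x
  have e2 := key2 i x
  have e3 := key1 i (x - (s₂ - s))
  have e4 := key2 i (x - (s₁ - s))
  rw [sub_right_comm] at e3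
  have n1 : x - (s₂ - s) ≠ x := by
    simpa [sub_eq_zero] using hs₂
  have n2 : s₁ - x ≠ x := fun h => ht₁ (by rw [sub_eq_iff_eq_add] at h; exact h.symm)
  rw [show s₁ - (x - (s₂ - s)) = s₁ - x + (s₂ - s) by abel] at e3
  rw [show s₂ - (x - (s₁ - s)) = s₂ + s₁ - s - x by abel] at e4
  rw [if_neg htu] at e2
  simp only [Prod.mk.injEq, true_and, if_true, n1, n2, if_false] at e1 e2 e3 e4 ⊢
  omega

/-- In units of `ε` the left side of `reflection_relation` is at least 1, so the first indicator on
the right must be 1, which locates `u`. -/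
theorem reflection_relation_same {f g h : I × G → ℤ} {ε : ℤ} (hε : ε = 1 ∨ ε = -1) {t u : I × G}
    (hg : ∀ x, g x = f x + if x = t then ε else 0) (hh : ∀ x, h x = f x + if x = u then ε else 0)
    {s s₁ s₂ : G} (hs : IsReflectionInvariant f s) (h₁ : IsReflectionInvariant g s₁)
    (h₂ : IsReflectionInvariant h s₂) (htu : t ≠ u) (hs₂ : s₂ ≠ s) (ht₁ : t.2 + t.2 ≠ s₁) :
    t.1 = u.1 ∧ (s₁ - t.2) + (s₂ - u.2) = s := by
  have := reflection_relation hg hh hs h₁ h₂ htu hs₂ ht₁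
  have h : (t.1, s₂ + s₁ - s - t.2) = u := by
    by_contra hne
    rw [if_neg hne] at this
    split_ifs at this <;> omega
  rw [← h]
  refine ⟨rfl, ?_⟩
  simp only
  abel

/-- Now `δ = -ε`, so balance requires the first indicator on the left or the last on the right. -/
theorem reflection_relation_opposite {f g h : I × G → ℤ} {ε : ℤ} (hε : ε = 1 ∨ ε = -1)
    {t u : I × G}
    (hg : ∀ x, g x = f x + if x = t then ε else 0) (hh : ∀ x, h x = f x + if x = u then -ε else 0)
    {s s₁ s₂ : G} (hs : IsReflectionInvariant f s) (h₁ : IsReflectionInvariant g s₁)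
    (h₂ : IsReflectionInvariant h s₂) (htu : t ≠ u) (hs₂ : s₂ ≠ s) (ht₁ : t.2 + t.2 ≠ s₁) :
    t.1 = u.1 ∧ (s₁ - t.2 = s - u.2 ∨ s₂ - u.2 = t.2) := by
  have := reflection_relation hg hh hs h₁ h₂ htu hs₂ ht₁
  have h : (t.1, t.2 - (s₁ - s)) = u ∨ (t.1, s₂ - t.2) = u := by
    by_contra! hne
    rw [if_neg hne.1, if_neg hne.2] at this
    split_ifs at this <;> omega
  rcases h with h | h <;> rw [← h] <;> refine ⟨rfl, ?_⟩
  · left; simp only; abel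
  · right; simp only; abel

/-- The function `f` with the points of `S` added. -/
def addPoints {X : Type*} [DecidableEq X] (f : X → ℤ) (S : Finset X) (x : X) : ℤ :=
  f x + if x ∈ S then 1 else 0

/-- `f + 1_S` has a period or a reflection symmetry for every `S ⊆ W`. -/
def AllSymmetric (f : I × G → ℤ) (W : Finset (I × G)) : Prop :=
  ∀ S ⊆ W, ¬ IsAperiodic (addPoints f S) ∨ ∃ s, IsReflectionInvariant (addPoints f S) s

theorem addPoints_symmDiff {X : Type*} [DecidableEq X] (f : X → ℤ) (S : Finset X) (t x : X) :
    addPoints f (symmDiff S {t}) x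
      = addPoints f S x + if x = t then (if t ∈ S then -1 else 1) else 0 := by
  unfold addPoints
  by_cases hx : x = t
  · subst hx
    by_cases h : x ∈ S <;> simp [Finset.mem_symmDiff, h]
  · simp [Finset.mem_symmDiff, hx]

theorem symmDiff_singleton_subset {X : Type*} [DecidableEq X] {S W : Finset X} {t : X}
    (hS : S ⊆ W) (ht : t ∈ W) : symmDiff S {t} ⊆ W := by
  intro x hx
  rw [Finset.mem_symmDiff, Finset.mem_singleton] at hx
  rcases hx with h | h
  · exact hS h.1
  · rw [h.1]; exact ht

variable {f : I × G → ℤ} {W S : Finset (I × G)}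

theorem exists_aperiodic_subset (f : I × G → ℤ) {t : I × G} (ht : t ∈ W) :
    ∃ S ⊆ W, IsAperiodic (addPoints f S) := by
  rcases isAperiodic_or_of_add_point (ε := 1) one_ne_zero (t := t) (f := addPoints f ∅)
    (g := addPoints f (symmDiff ∅ {t})) (by simpa using addPoints_symmDiff f ∅ t) with h | h
  · exact ⟨_, Finset.empty_subset _, h⟩
  · exact ⟨_, symmDiff_singleton_subset (Finset.empty_subset _) ht, h⟩

theorem AllSymmetric.exists_reflection (h : AllSymmetric f W) (hS : S ⊆ W)
    (ha : IsAperiodic (addPoints f S)) : ∃ s, IsReflectionInvariant (addPoints f S) s :=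
  (h S hS).resolve_left (not_not.mpr ha)

theorem AllSymmetric.step (h : AllSymmetric f W) (hS : S ⊆ W) (ha : IsAperiodic (addPoints f S))
    {s : G} (hs : IsReflectionInvariant (addPoints f S) s) {t : I × G} (ht : t ∈ W)
    (hts : t.2 + t.2 ≠ s) :
    IsAperiodic (addPoints f (symmDiff S {t})) ∧
      ∃ s', IsReflectionInvariant (addPoints f (symmDiff S {t})) s' ∧ s' ≠ s ∧
        t.2 + t.2 ≠ s' := by
  have hε : (if t ∈ S then -1 else 1 : ℤ) ≠ 0 := by split_ifs <;> simp
  have h1 : IsAperiodic (addPoints f (symmDiff S {t})) :=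
    IsAperiodic.add_point hε (addPoints_symmDiff f S t) hs hts
  obtain ⟨s', hs'⟩ := h.exists_reflection (symmDiff_singleton_subset hS ht) h1
  exact ⟨h1, s', hs', reflection_ne_of_add_point hε (addPoints_symmDiff f S t) ha hs hts hs'⟩

theorem symmDiff_relation_same {s : G}
    (hs : IsReflectionInvariant (addPoints f S) s) {t u : I × G} (htu : t ≠ u)
    (hc : t ∈ S ↔ u ∈ S) {s₁ s₂ : G}
    (h₁ : IsReflectionInvariant (addPoints f (symmDiff S {t})) s₁)
    (h₂ : IsReflectionInvariant (addPoints f (symmDiff S {u})) s₂) (hs₂ : s₂ ≠ s)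
    (ht₁ : t.2 + t.2 ≠ s₁) : t.1 = u.1 ∧ (s₁ - t.2) + (s₂ - u.2) = s := by
  have hε : (if t ∈ S then -1 else 1 : ℤ) = 1 ∨ (if t ∈ S then -1 else 1 : ℤ) = -1 := by
    split_ifs <;> simp
  refine reflection_relation_same hε (addPoints_symmDiff f S t) (u := u) ?_ hs h₁ h₂ htu hs₂ ht₁
  simpa only [hc] using addPoints_symmDiff f S u

theorem symmDiff_relation_opposite {s : G}
    (hs : IsReflectionInvariant (addPoints f S) s) {t u : I × G}
    (hc : t ∈ S ↔ u ∉ S) {s₁ s₂ : G}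
    (h₁ : IsReflectionInvariant (addPoints f (symmDiff S {t})) s₁)
    (h₂ : IsReflectionInvariant (addPoints f (symmDiff S {u})) s₂) (hs₂ : s₂ ≠ s)
    (ht₁ : t.2 + t.2 ≠ s₁) :
    t.1 = u.1 ∧ (s₁ - t.2 = s - u.2 ∨ s₂ - u.2 = t.2) := by
  have hε : (if t ∈ S then -1 else 1 : ℤ) = 1 ∨ (if t ∈ S then -1 else 1 : ℤ) = -1 := by
    split_ifs <;> simp
  have htu : t ≠ u := by rintro rfl; tauto
  refine reflection_relation_opposite hε (addPoints_symmDiff f S t) (u := u) ?_ hs h₁ h₂ htu hs₂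
    ht₁
  intro x
  rw [addPoints_symmDiff f S u]
  by_cases h : u ∈ S <;> simp [hc, h]

/-- Two points on different circles and different lines always allow an asymmetric extension. -/
theorem not_allSymmetric_of_fst_ne {t u : I × G} (h1 : t.1 ≠ u.1) (h2 : t.2 + t.2 ≠ u.2 + u.2)
    (f : I × G → ℤ) : ¬ AllSymmetric f {t, u} := by
  intro h
  have ht : t ∈ ({t, u} : Finset (I × G)) := by simp
  have hu : u ∈ ({t, u} : Finset (I × G)) := by simp
  -- When both points are off the axis, the relations force equal radii. The axis cannot contain
  -- both points, and if it contains one, toggling the other moves it off both.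
  have good : ∀ S ⊆ ({t, u} : Finset (I × G)), IsAperiodic (addPoints f S) → ∀ s,
      IsReflectionInvariant (addPoints f S) s → t.2 + t.2 ≠ s → u.2 + u.2 ≠ s → False := by
    intro S hS ha s hs hts hus
    obtain ⟨-, s₁, h₁, -, ht₁⟩ := h.step hS ha hs ht hts
    obtain ⟨-, s₂, h₂, hs₂, -⟩ := h.step hS ha hs hu hus
    by_cases hc : t ∈ S ↔ u ∈ S
    · exact h1 (symmDiff_relation_same hs (fun e => h1 (by rw [e])) hc h₁ h₂ hs₂ ht₁).1
    · exact h1 (symmDiff_relation_opposite hs (by tauto) h₁ h₂ hs₂ ht₁).1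
  obtain ⟨S, hS, ha⟩ := exists_aperiodic_subset f ht
  obtain ⟨s, hs⟩ := h.exists_reflection hS ha
  by_cases hts : t.2 + t.2 = s
  · obtain ⟨ha', s', hs', hne, hus'⟩ := h.step hS ha hs hu (fun e => h2 (hts.trans e.symm))
    exact good _ (symmDiff_singleton_subset hS hu) ha' s' hs' (hts ▸ hne.symm) hus'
  by_cases hus : u.2 + u.2 = s
  · obtain ⟨ha', s', hs', hne, hts'⟩ := h.step hS ha hs ht hts
    exact good _ (symmDiff_singleton_subset hS ht) ha' s' hs' hts' (hus ▸ hne.symm)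
  exact good S hS ha s hs hts hus

/-- The images of `t`, `u`, `v` under their own new reflections sum pairwise to `s`, so all equal
one `b` with `b + b = s`. The relations with `w`, in both orders, then put `t` or `w` on the axis.
-/
theorem AllSymmetric.three_same (h : AllSymmetric f W) (hS : S ⊆ W)
    (ha : IsAperiodic (addPoints f S)) {s : G} (hs : IsReflectionInvariant (addPoints f S) s)
    {t u v w : I × G} (ht : t ∈ W ∧ t.2 + t.2 ≠ s) (hu : u ∈ W ∧ u.2 + u.2 ≠ s)
    (hv : v ∈ W ∧ v.2 + v.2 ≠ s) (hw : w ∈ W ∧ w.2 + w.2 ≠ s) (htu : t ≠ u) (htv : t ≠ v)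
    (huv : u ≠ v) (cu : t ∈ S ↔ u ∈ S) (cv : t ∈ S ↔ v ∈ S) (cw : t ∈ S ↔ w ∉ S) : False := by
  obtain ⟨-, s₁, h₁, n₁, m₁⟩ := h.step hS ha hs ht.1 ht.2
  obtain ⟨-, s₂, h₂, n₂, m₂⟩ := h.step hS ha hs hu.1 hu.2
  obtain ⟨-, s₃, h₃, n₃, m₃⟩ := h.step hS ha hs hv.1 hv.2
  obtain ⟨-, s₄, h₄, n₄, m₄⟩ := h.step hS ha hs hw.1 hw.2
  have a := (symmDiff_relation_same hs htu cu h₁ h₂ n₂ m₁).2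
  have b := (symmDiff_relation_same hs htv cv h₁ h₃ n₃ m₁).2
  have c := (symmDiff_relation_same hs huv (by tauto) h₂ h₃ n₃ m₂).2
  have d := (symmDiff_relation_opposite hs cw h₁ h₄ n₄ m₁).2
  have e := (symmDiff_relation_opposite hs (by tauto) h₄ h₁ n₁ m₄).2
  have hb : s₂ - u.2 = s₃ - v.2 := add_left_cancel (a.trans b.symm)
  have hb' : s₁ - t.2 = s₃ - v.2 := by
    rw [← hb] at c
    rw [← hb]
    exact add_right_cancel (a.trans c.symm)
  have hb2 : (s₁ - t.2) + (s₁ - t.2) = s := by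
    rw [← hb'] at b
    exact b
  have hd : s₁ - t.2 ≠ s - w.2 := by
    intro hd
    rw [hd] at hb2
    apply hw.2
    have : s = w.2 + w.2 + ((s - w.2 + (s - w.2)) - s) := by abel
    rw [this, hb2]
    abel
  have d' := d.resolve_left hd
  rcases e with e | e
  · apply ht.2
    rw [d'] at e
    exact (sub_eq_iff_eq_add.mp e.symm).symm
  · apply hw.2
    rw [← e]
    exact hb2

/-- If off-axis points of both colours occur, then there are at most two of each colour. -/
theorem AllSymmetric.card_of_mixed (h : AllSymmetric f W) (hS : S ⊆ W)
    (ha : IsAperiodic (addPoints f S)) {s : G} (hs : IsReflectionInvariant (addPoints f S) s)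
    {t w : I × G} (ht : t ∈ W ∧ t.2 + t.2 ≠ s) (hw : w ∈ W ∧ w.2 + w.2 ≠ s)
    (htw : t ∈ S ↔ w ∉ S) : (W.filter fun x => x.2 + x.2 ≠ s).card ≤ 4 := by
  by_contra! hc
  have hor : 2 < ((W.filter fun x => x.2 + x.2 ≠ s).filter (· ∈ S)).card ∨
      2 < ((W.filter fun x => x.2 + x.2 ≠ s).filter (· ∉ S)).card := by
    have := Finset.card_filter_add_card_filter_not (s := W.filter fun x => x.2 + x.2 ≠ s) (· ∈ S)
    omega
  obtain ⟨w', hw', hw'S⟩ : ∃ w', (w' ∈ W ∧ w'.2 + w'.2 ≠ s) ∧ w' ∉ S := by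
    by_cases htS : t ∈ S
    · exact ⟨w, hw, htw.mp htS⟩
    · exact ⟨t, ht, htS⟩
  obtain ⟨t', ht', ht'S⟩ : ∃ t', (t' ∈ W ∧ t'.2 + t'.2 ≠ s) ∧ t' ∈ S := by
    by_cases htS : t ∈ S
    · exact ⟨t, ht, htS⟩
    · exact ⟨w, hw, by tauto⟩
  rcases hor with h2 | h2
  · obtain ⟨a, ha', b, hb, c, hc, hab, hac, hbc⟩ := Finset.two_lt_card.mp h2
    simp only [Finset.mem_filter] at ha' hb hc
    exact h.three_same hS ha hs ha'.1 hb.1 hc.1 hw' hab hac hbc (by tauto) (by tauto) (by tauto)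
  · obtain ⟨a, ha', b, hb, c, hc, hab, hac, hbc⟩ := Finset.two_lt_card.mp h2
    simp only [Finset.mem_filter] at ha' hb hc
    exact h.three_same hS ha hs ha'.1 hb.1 hc.1 ht' hab hac hbc (by tauto) (by tauto) (by tauto)

/-- If every double `x + x` is taken at most twice, then the points of `W` off an axis do not all
have the same colour. -/
theorem AllSymmetric.exists_mixed (h : AllSymmetric f W) {i : I} (hi : ∀ w ∈ W, w.1 = i)
    (hW : W.card = 6) (h2 : ∀ s, (W.filter fun x => x.2 + x.2 = s).card ≤ 2) (hS : S ⊆ W)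
    (ha : IsAperiodic (addPoints f S)) {s : G} (hs : IsReflectionInvariant (addPoints f S) s) :
    ∃ t w : I × G, (t ∈ W ∧ t.2 + t.2 ≠ s) ∧ (w ∈ W ∧ w.2 + w.2 ≠ s) ∧ t ∈ S ∧ w ∉ S := by
  have hcard : ∀ s, (W.filter fun x => x.2 + x.2 = s).card
      + (W.filter fun x => x.2 + x.2 ≠ s).card = 6 := fun s => by
    rw [← hW]; exact Finset.card_filter_add_card_filter_not _
  set Gd := W.filter fun x => x.2 + x.2 ≠ s with hGd
  have hGd4 : 4 ≤ Gd.card := by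
    have h5 : _ + Gd.card = 6 := hcard s
    have := h2 s
    omega
  by_contra! hmono
  have mono : ∀ x ∈ Gd, ∀ y ∈ Gd, x ∈ S ↔ y ∈ S := by
    intro x hx y hy
    simp only [hGd, Finset.mem_filter] at hx hy
    have := hmono x y hx hy
    have := hmono y x hy hx
    tauto
  have step : ∀ x ∈ Gd, _ := fun x hx => h.step hS ha hs (Finset.mem_filter.mp hx).1
    (Finset.mem_filter.mp hx).2
  choose! hap ax hax hne hgood using step
  -- A common third point `z` shows that equal new axes come from equal points.
  have hinj : ∀ x ∈ Gd, ∀ y ∈ Gd, ax x = ax y → x = y := by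
    intro x hx y hy hxy
    by_contra hne'
    obtain ⟨z, hz, hzx, hzy⟩ : ∃ z ∈ Gd, z ≠ x ∧ z ≠ y := by
      have : 0 < ((Gd.erase x).erase y).card := by
        have := Finset.pred_card_le_card_erase (s := Gd) (a := x)
        have := Finset.pred_card_le_card_erase (s := Gd.erase x) (a := y)
        omega
      obtain ⟨z, hz⟩ := Finset.card_pos.mp this
      simp only [Finset.mem_erase] at hz
      exact ⟨z, hz.2.2, hz.2.1, hz.1⟩
    have e1 := (symmDiff_relation_same hs hzx.symm (mono x hx z hz) (hax x hx) (hax z hz)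
      (hne z hz) (hgood x hx)).2
    have e2 := (symmDiff_relation_same hs hzy.symm (mono y hy z hz) (hax y hy) (hax z hz)
      (hne z hz) (hgood y hy)).2
    have e3 := add_right_cancel (e1.trans e2.symm)
    rw [hxy] at e3
    refine hne' (Prod.ext ?_ (sub_right_injective e3))
    rw [hi x (Finset.mem_filter.mp hx).1, hi y (Finset.mem_filter.mp hy).1]
  -- After toggling `t`, both colors occur off the axis `ax t`, so at most four points are off it
  -- and at least two of the six are on it. These lie in `Gd` because `ax t ≠ s`.
  have fiber : ∀ t ∈ Gd, 2 ≤ (Gd.filter fun x => x.2 + x.2 = ax t).card := by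
    intro t ht
    have htW := (Finset.mem_filter.mp ht).1
    obtain ⟨w, hw, hwt, hwa⟩ : ∃ w ∈ Gd, w ≠ t ∧ w.2 + w.2 ≠ ax t := by
      by_contra! hall
      have hsub : Gd.erase t ⊆ W.filter fun x => x.2 + x.2 = ax t := by
        intro x hx
        rw [Finset.mem_erase] at hx
        exact Finset.mem_filter.mpr ⟨(Finset.mem_filter.mp hx.2).1, hall x hx.2 hx.1⟩
      have := Finset.card_le_card hsub
      have := h2 (ax t)
      have := Finset.pred_card_le_card_erase (s := Gd) (a := t)
      omega
    have hmix := h.card_of_mixed (symmDiff_singleton_subset hS htW) (hap t ht) (hax t ht)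
      ⟨htW, hgood t ht⟩ ⟨(Finset.mem_filter.mp hw).1, hwa⟩ (by
        have := mono t ht w hw
        simp only [Finset.mem_symmDiff, Finset.mem_singleton, hwt]
        tauto)
    have hsub : (W.filter fun x => x.2 + x.2 = ax t) ⊆ Gd.filter fun x => x.2 + x.2 = ax t := by
      intro x hx
      rw [Finset.mem_filter] at hx
      exact Finset.mem_filter.mpr
        ⟨Finset.mem_filter.mpr ⟨hx.1, hx.2 ▸ hne t ht⟩, hx.2⟩
    have := Finset.card_le_card hsub
    have := hcard (ax t)
    omega
  have hdisj : (Gd : Set (I × G)).PairwiseDisjoint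
      fun t => Gd.filter fun x => x.2 + x.2 = ax t := by
    intro a ha b hb hab
    rw [Function.onFun, Finset.disjoint_left]
    intro x hx hx'
    exact hab (hinj a ha b hb ((Finset.mem_filter.mp hx).2.symm.trans (Finset.mem_filter.mp hx').2))
  -- Disjoint subsets of `Gd`, one for each of its elements and each of size at least 2, cannot fit.
  have h1 := Finset.card_biUnion hdisj
  have h3 := Finset.card_nsmul_le_sum Gd _ 2 fiber
  have h4 : (Gd.biUnion fun t => Gd.filter fun x => x.2 + x.2 = ax t).card ≤ Gd.card :=
    Finset.card_le_card (Finset.biUnion_subset.mpr fun t _ => Finset.filter_subset _ _)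
  rw [smul_eq_mul] at h3
  omega

/-- Six points on a circle allow an asymmetric extension. -/
theorem not_allSymmetric_of_card_eq_six {i : I} (hi : ∀ w ∈ W, w.1 = i) (hW : W.card = 6)
    (h2 : ∀ s, (W.filter fun x => x.2 + x.2 = s).card ≤ 2) (f : I × G → ℤ) :
    ¬ AllSymmetric f W := by
  intro h
  -- There is always an off-axis point outside `S`; adding it keeps aperiodicity, so `S` would
  -- outgrow `W`.
  have grow : ∀ n : ℕ, ∃ S ⊆ W, IsAperiodic (addPoints f S) ∧ n ≤ S.card := by
    intro n
    induction n with
    | zero =>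
      obtain ⟨t, ht⟩ := Finset.card_pos.mp (by omega : 0 < W.card)
      obtain ⟨S, hS, ha⟩ := exists_aperiodic_subset f ht
      exact ⟨S, hS, ha, Nat.zero_le _⟩
    | succ n ih =>
      obtain ⟨S, hS, ha, hn⟩ := ih
      obtain ⟨s, hs⟩ := h.exists_reflection hS ha
      obtain ⟨-, w, -, hw, -, hwS⟩ := h.exists_mixed hi hW h2 hS ha hs
      refine ⟨_, symmDiff_singleton_subset hS hw.1, (h.step hS ha hs hw.1 hw.2).1, ?_⟩
      rw [(Finset.disjoint_singleton_right.mpr hwS).symmDiff_eq_sup, Finset.sup_eq_union,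
        Finset.card_union_of_disjoint (Finset.disjoint_singleton_right.mpr hwS),
        Finset.card_singleton]
      omega
  obtain ⟨S, hS, -, h7⟩ := grow 7
  have := Finset.card_le_card hS
  omega

end Dihedral

/-! ### Affine symmetries of the complex plane: almost periods and moments. -/

section Affine

open Filter

/-- `f` is invariant under `z ↦ a z + b`. -/
def IsAffineInvariant (f : ℂ → ℤ) (a b : ℂ) : Prop := ∀ z, f (a * z + b) = f z

/-- `v` is a period of `f` up to finitely many points. -/
def IsAlmostPeriod (f : ℂ → ℤ) (v : ℂ) : Prop := (fun z => f (z + v)) =ᶠ[cofinite] f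

theorem tendsto_add_const_cofinite (v : ℂ) : Tendsto (fun z : ℂ => z + v) cofinite cofinite :=
  (add_left_injective v).tendsto_cofinite

theorem tendsto_sub_nat_mul_cofinite {v : ℂ} (hv : v ≠ 0) (x : ℂ) :
    Tendsto (fun n : ℕ => x - n * v) atTop cofinite := by
  rw [← Nat.cofinite_eq_atTop]
  apply Function.Injective.tendsto_cofinite
  intro m n h
  simpa [hv] using h

theorem IsAlmostPeriod.congr {f g : ℂ → ℤ} (hfg : f =ᶠ[cofinite] g) {v : ℂ}
    (h : IsAlmostPeriod f v) : IsAlmostPeriod g v := by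
  have h1 : (fun z => f (z + v)) =ᶠ[cofinite] fun z => g (z + v) :=
    (tendsto_add_const_cofinite v).eventually hfg
  exact h1.symm.trans (h.trans hfg)

theorem addPoints_eventuallyEq (f : ℂ → ℤ) (S : Finset ℂ) : addPoints f S =ᶠ[cofinite] f := by
  filter_upwards [S.finite_toSet.compl_mem_cofinite] with z hz
  have : z ∉ S := hz
  simp [addPoints, this]

theorem IsAlmostPeriod.mul {f : ℂ → ℤ} {a b v : ℂ} (ha : a ≠ 0) (hf : IsAffineInvariant f a b)
    (h : IsAlmostPeriod f v) : IsAlmostPeriod f (a * v) := by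
  have ht : Tendsto (fun z : ℂ => a⁻¹ * (z - b)) cofinite cofinite := by
    apply Function.Injective.tendsto_cofinite
    intro x y hxy
    simpa [ha] using hxy
  have h' := ht.eventually h
  unfold IsAlmostPeriod
  filter_upwards [h'] with z hz
  rw [← hf, ← hf (a⁻¹ * (z - b))] at hz
  rwa [show a * (a⁻¹ * (z - b) + v) + b = z + a * v by field_simp; ring,
    show a * (a⁻¹ * (z - b)) + b = z by field_simp; ring] at hz

theorem eq_zero_of_period {D : ℂ → ℤ} (hD : D =ᶠ[cofinite] 0) {v : ℂ} (hv : v ≠ 0)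
    (hper : ∀ z, D (z + v) = D z) (x : ℂ) : D x = 0 := by
  obtain ⟨n, hn⟩ := ((tendsto_sub_nat_mul_cofinite hv x).eventually hD).exists
  have : ∀ n : ℕ, D (x - n * v) = D x := by
    intro n
    induction n with
    | zero => simp
    | succ n ih =>
      rw [← ih, ← hper (x - (n + 1 : ℕ) * v)]
      congr 1
      push_cast
      ring
  rw [← this n, hn]
  rfl

theorem IsAlmostPeriod.eventually_const {f : ℂ → ℤ} {v : ℂ} (hv : v ≠ 0) (h : IsAlmostPeriod f v)
    (x : ℂ) : ∃ c, ∀ᶠ n : ℕ in atTop, f (x - n * v) = c := by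
  obtain ⟨N, hN⟩ := eventually_atTop.mp ((tendsto_sub_nat_mul_cofinite hv x).eventually h)
  refine ⟨f (x - N * v), eventually_atTop.mpr ⟨N, fun n hn => ?_⟩⟩
  induction n, hn using Nat.le_induction with
  | base => rfl
  | succ n hn ih =>
    rw [← ih, ← hN (n + 1) (by omega)]
    simp only
    congr 1
    push_cast
    ring

/-- A function with two independent almost periods agrees, up to finitely many points, with a
function for which every almost period is a period. -/
theorem exists_periodic_part {f : ℂ → ℤ} {v w : ℂ} (hv0 : v ≠ 0) (hv : IsAlmostPeriod f v)
    (hw : IsAlmostPeriod f w) (hvw : ∀ m n : ℤ, m * w = n * v → m = 0) :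
    ∃ F : ℂ → ℤ, f =ᶠ[cofinite] F ∧ ∀ u, IsAlmostPeriod f u → ∀ z, F (z + u) = F z := by
  -- `F x` is the eventual value of `f` along `x - n * v`.
  choose F hF using hv.eventually_const hv0
  have hper : ∀ u, IsAlmostPeriod f u → ∀ z, F (z + u) = F z := by
    intro u hu z
    obtain ⟨n, h1, h2, h3⟩ := ((hF (z + u)).and ((hF z).and
      ((tendsto_sub_nat_mul_cofinite hv0 z).eventually hu))).exists
    rw [← h1, ← h2, ← h3]
    congr 1
    ring
  refine ⟨F, ?_, hper⟩
  have hA : {z | ¬ f (z + v) = f z}.Finite := hv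
  have hB : {z | ¬ f (z + w) = f z}.Finite := hw
  have claim1 : ∀ x, f x ≠ F x → ∃ e ∈ {z | ¬ f (z + v) = f z}, ∃ j : ℤ, x = e + j * v := by
    intro x hx
    by_contra! hne
    have hc : ∀ n : ℕ, f (x - n * v) = f x := by
      intro n
      induction n with
      | zero => simp
      | succ n ih =>
        rw [← ih]
        by_contra hcon
        refine hne (x - (n + 1 : ℕ) * v) (fun h => hcon ?_) (n + 1 : ℕ) (by push_cast; ring)
        rw [← h]
        congr 1
        push_cast
        ring
    obtain ⟨n, hn⟩ := (hF x).exists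
    exact hx ((hc n).symm.trans hn)
  -- Otherwise all `x + n * w` are exceptional. By `claim1` they lie on finitely many cosets of `ℤ
  -- v`, and two on the same coset contradict independence.
  have claim2 : ∀ x, f x ≠ F x → ∃ e ∈ {z | ¬ f (z + w) = f z}, ∃ j : ℤ, x = e + j * w := by
    intro x hx
    by_contra! hne
    have hc : ∀ n : ℕ, f (x + n * w) = f x ∧ F (x + n * w) = F x := by
      intro n
      induction n with
      | zero => simp
      | succ n ih =>
        rw [← ih.1, ← ih.2, show x + (n + 1 : ℕ) * w = x + n * w + w by push_cast; ring]
        refine ⟨?_, hper w hw _⟩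
        by_contra hcon
        exact hne (x + n * w) hcon (-n) (by push_cast; ring)
    have hex : ∀ n : ℕ, ∃ e : {z | ¬ f (z + v) = f z}, ∃ j : ℤ, x + n * w = e + j * v := by
      intro n
      obtain ⟨e, he, j, hj⟩ := claim1 (x + n * w) (by rw [(hc n).1, (hc n).2]; exact hx)
      exact ⟨⟨e, he⟩, j, hj⟩
    choose e j he using hex
    have := hA.to_subtype
    obtain ⟨m, n, hmn, hemn⟩ := Finite.exists_ne_map_eq_of_infinite e
    have h1 := he m
    rw [hemn] at h1
    have := hvw (m - n) (j m - j n) (by push_cast; linear_combination h1 - he n)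
    omega
  have hsub : {x | ¬ f x = F x} ⊆ ⋃ e ∈ {z | ¬ f (z + v) = f z}, ⋃ e' ∈ {z | ¬ f (z + w) = f z},
      {x | (∃ j : ℤ, x = e + j * v) ∧ ∃ m : ℤ, x = e' + m * w} := by
    intro x hx
    obtain ⟨e, he, h1⟩ := claim1 x hx
    obtain ⟨e', he', h2⟩ := claim2 x hx
    simp only [Set.mem_iUnion]
    exact ⟨e, he, e', he', h1, h2⟩
  -- A coset of `ℤ v` and a coset of `ℤ w` meet in at most one point.
  refine Set.Finite.subset (hA.biUnion fun e _ => hB.biUnion fun e' _ => ?_) hsub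
  apply Set.Subsingleton.finite
  rintro x ⟨⟨j, hj⟩, m, hm⟩ y ⟨⟨j', hj'⟩, m', hm'⟩
  have := hvw (m - m') (j - j') (by push_cast; linear_combination hj - hm - hj' + hm')
  rw [hm, hm', sub_eq_zero.mp this]

/-- The moments of a finitely supported function. -/
noncomputable def moment (h : ℂ → ℤ) (k : ℕ) : ℂ := ∑ᶠ z, (h z : ℂ) * z ^ k

theorem IsAffineInvariant.moment_eq {h : ℂ → ℤ} (hfin : h =ᶠ[cofinite] 0) {a b : ℂ} (ha : a ≠ 0)
    (hinv : IsAffineInvariant h a b) :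
    moment h 1 = a * moment h 1 + b * moment h 0 ∧
    moment h 2 = a ^ 2 * moment h 2 + 2 * a * b * moment h 1 + b ^ 2 * moment h 0 ∧
    moment h 3 = a ^ 3 * moment h 3 + 3 * a ^ 2 * b * moment h 2 + 3 * a * b ^ 2 * moment h 1
      + b ^ 3 * moment h 0 := by
  have hT : {z | ¬ h z = (0 : ℂ → ℤ) z}.Finite := hfin
  have hsum : ∀ φ : ℂ → ℂ, ∑ᶠ z, (h z : ℂ) * φ z = ∑ z ∈ hT.toFinset, (h z : ℂ) * φ z := by
    intro φ
    apply finsum_eq_sum_of_support_subset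
    intro z hz
    simp only [Function.mem_support, ne_eq, mul_eq_zero, not_or, Int.cast_eq_zero] at hz
    simpa using hz.1
  have hbij : Function.Bijective fun z : ℂ => a * z + b := by
    refine ⟨fun x y hxy => by simpa [ha] using hxy, fun y => ⟨a⁻¹ * (y - b), ?_⟩⟩
    simp only
    field_simp
    ring
  have hcomp : ∀ φ : ℂ → ℂ, ∑ᶠ z, (h z : ℂ) * φ z = ∑ᶠ z, (h z : ℂ) * φ (a * z + b) := by
    intro φ
    rw [← finsum_comp _ hbij]
    exact finsum_congr fun z => by rw [hinv z]
  have hm : ∀ k, moment h k = ∑ z ∈ hT.toFinset, (h z : ℂ) * (a * z + b) ^ k := fun k => by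
    rw [moment, hcomp, hsum]
  have hm' : ∀ k, moment h k = ∑ z ∈ hT.toFinset, (h z : ℂ) * z ^ k := fun k => hsum _
  refine ⟨(hm 1).trans ?_, (hm 2).trans ?_, (hm 3).trans ?_⟩ <;>
    simp only [hm', Finset.mul_sum, ← Finset.sum_add_distrib] <;>
    exact Finset.sum_congr rfl fun z _ => by ring

/-- The symmetry fixes the barycenter and multiplies the `j`-th central moment by `a ^ j`. Hence the
third one vanishes if `a = -1` and the second one otherwise; the factors are these moments with
denominators cleared. -/
theorem IsAffineInvariant.moment_relation {h : ℂ → ℤ} (hfin : h =ᶠ[cofinite] 0) {a b : ℂ}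
    (ha : a ≠ 0) (hinv : IsAffineInvariant h a b) (hab : ¬ (a = 1 ∧ b = 0))
    (h0 : moment h 0 ≠ 0) :
    (moment h 0 * moment h 2 - moment h 1 ^ 2) * (moment h 0 ^ 2 * moment h 3
      - 3 * moment h 0 * moment h 1 * moment h 2 + 2 * moment h 1 ^ 3) = 0 := by
  obtain ⟨e1, e2, e3⟩ := hinv.moment_eq hfin ha
  generalize moment h 0 = K at *
  generalize moment h 1 = M at *
  generalize moment h 2 = Q at *
  generalize moment h 3 = R at *
  have ha1 : 1 - a ≠ 0 := by
    intro h1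
    have h1' : a = 1 := (sub_eq_zero.mp h1).symm
    subst h1'
    have : b * K = 0 := by linear_combination -e1
    exact hab ⟨rfl, (mul_eq_zero.mp this).resolve_right h0⟩
  obtain ⟨c, rfl⟩ : ∃ c, M = K * c := ⟨M / K, by field_simp⟩
  have hb : b = (1 - a) * c := by
    apply mul_right_cancel₀ h0
    linear_combination -e1
  subst hb
  by_cases ha2 : 1 + a = 0
  · have : a = -1 := by linear_combination ha2
    subst this
    have : K ^ 2 * R - 3 * K * (K * c) * Q + 2 * (K * c) ^ 3 = 0 := by
      linear_combination K ^ 2 / 2 * e3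
    rw [this, mul_zero]
  · have : K * Q - (K * c) ^ 2 = 0 := by
      apply (mul_eq_zero.mp _).resolve_left (mul_ne_zero ha1 ha2)
      linear_combination K * e2
    rw [this, zero_mul]

theorem moment_addPoints {h : ℂ → ℤ} (hfin : h =ᶠ[cofinite] 0) (S : Finset ℂ) (k : ℕ) :
    moment (addPoints h S) k = moment h k + ∑ z ∈ S, z ^ k := by
  have hT : {z | ¬ h z = (0 : ℂ → ℤ) z}.Finite := hfin
  have h1 : moment h k = ∑ z ∈ hT.toFinset ∪ S, (h z : ℂ) * z ^ k := by
    apply finsum_eq_sum_of_support_subset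
    intro z hz
    simp only [Function.mem_support, ne_eq, mul_eq_zero, not_or, Int.cast_eq_zero] at hz
    simp [hz.1]
  have h2 : moment (addPoints h S) k
      = ∑ z ∈ hT.toFinset ∪ S, (addPoints h S z : ℂ) * z ^ k := by
    apply finsum_eq_sum_of_support_subset
    intro z hz
    simp only [Function.mem_support, ne_eq, mul_eq_zero, not_or, Int.cast_eq_zero, addPoints] at hz
    by_cases hzS : z ∈ S
    · simp [hzS]
    · simp only [hzS, if_false, add_zero] at hz
      simp [hz.1]
  have h3 : ∑ z ∈ S, z ^ k = ∑ z ∈ hT.toFinset ∪ S, if z ∈ S then z ^ k else 0 := by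
    rw [← Finset.sum_filter]
    congr 1
    ext z
    simp only [Finset.mem_filter, Finset.mem_union]
    tauto
  rw [h1, h2, h3, ← Finset.sum_add_distrib]
  refine Finset.sum_congr rfl fun z _ => ?_
  unfold addPoints
  split_ifs <;> push_cast <;> ring

/-- A finitely supported function can be made asymmetric on any set of nine points. -/
theorem exists_asymmetric_of_finite_support {h : ℂ → ℤ} (hfin : h =ᶠ[cofinite] 0) {W : Finset ℂ}
    (hW : 9 ≤ W.card) : ∃ S ⊆ W, ∀ a b : ℂ, a ≠ 0 → IsAffineInvariant (addPoints h S) a b →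
      a = 1 ∧ b = 0 := by
  by_contra! hcon
  obtain ⟨k, hk⟩ : ∃ k : ℤ, moment h 0 = k := by
    have hT : {z | ¬ h z = (0 : ℂ → ℤ) z}.Finite := hfin
    refine ⟨∑ z ∈ hT.toFinset, h z, ?_⟩
    push_cast
    simp only [moment, pow_zero, mul_one]
    apply finsum_eq_sum_of_support_subset
    intro z hz
    simpa using hz
  -- Adding `0` or `3` points gives the total mass `K` absolute value at least 2, so `K`, `K - 1`
  -- and `K + 1` are nonzero.
  obtain ⟨j, hj, hkj⟩ : ∃ j : ℕ, j ≤ 3 ∧ (2 ≤ k + j ∨ k + j ≤ -2) := by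
    by_cases hk : k ≤ -2
    · exact ⟨0, by omega, by omega⟩
    · exact ⟨3, by omega, by omega⟩
  obtain ⟨S, hS, hSj⟩ := Finset.exists_subset_card_eq (by omega : j ≤ W.card)
  have hfinS : addPoints h S =ᶠ[cofinite] 0 := (addPoints_eventuallyEq h S).trans hfin
  have hmS : moment (addPoints h S) 0 = (k + j : ℤ) := by
    rw [moment_addPoints hfin, hk]
    simp [hSj]
  have hmom : ∀ t ∈ W \ S, ∀ i,
      moment (addPoints h (insert t S)) i = moment (addPoints h S) i + t ^ i := by
    intro t ht i
    rw [moment_addPoints hfin, moment_addPoints hfin,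
      Finset.sum_insert (Finset.mem_sdiff.mp ht).2]
    ring
  set K := moment (addPoints h S) 0
  set M := moment (addPoints h S) 1
  set Q := moment (addPoints h S) 2
  set R := moment (addPoints h S) 3
  have hK0 : K ≠ 0 := by
    rw [hmS]; exact_mod_cast (by omega : k + j ≠ 0)
  have hK1 : K - 1 ≠ 0 := by
    rw [hmS]; exact_mod_cast (by omega : k + j - 1 ≠ 0)
  have hK2 : K + 1 ≠ 0 := by
    rw [hmS]; exact_mod_cast (by omega : k + j + 1 ≠ 0)
  -- `P` and `P'` are the two factors of `moment_relation` after one further point `t` is added, as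
  -- polynomials in `t`. Their product has degree 5, while at least `9 - 3 = 6` points remain as
  -- roots.
  open Polynomial in
  let P : ℂ[X] := C K * X ^ 2 + C (-2 * M) * X + C ((K + 1) * Q - M ^ 2)
  open Polynomial in
  let P' : ℂ[X] := C (K * (K - 1)) * X ^ 3 + C (-3 * (K + 1) * M + 6 * M) * X ^ 2
      + C (-3 * (K + 1) * Q + 6 * M ^ 2) * X + C ((K + 1) ^ 2 * R - 3 * (K + 1) * M * Q + 2 * M ^ 3)
  have hP : P.natDegree = 2 := Polynomial.natDegree_quadratic hK0
  have hP' : P'.natDegree = 3 := Polynomial.natDegree_cubic (mul_ne_zero hK0 hK1)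
  have hPP' : P * P' = 0 := by
    apply Polynomial.eq_zero_of_natDegree_lt_card_of_eval_eq_zero' _ (W \ S)
    · intro t ht
      have htW := Finset.mem_sdiff.mp ht
      obtain ⟨a, b, ha, hinv, hab⟩ := hcon (insert t S) (Finset.insert_subset htW.1 hS)
      have hrel := hinv.moment_relation ((addPoints_eventuallyEq h _).trans hfin) ha
        (fun hh => hab hh.1 hh.2) (by rw [hmom t ht, pow_zero]; exact hK2)
      rw [hmom t ht, hmom t ht, hmom t ht, hmom t ht] at hrel
      simp only [P, P', Polynomial.eval_mul, Polynomial.eval_add, Polynomial.eval_C,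
        Polynomial.eval_pow, Polynomial.eval_X]
      linear_combination hrel
    · have := Polynomial.natDegree_mul_le (p := P) (q := P')
      have := Finset.le_card_sdiff S W
      omega
  rcases mul_eq_zero.mp hPP' with h | h
  · rw [h] at hP; simp at hP
  · rw [h] at hP'; simp at hP'

/-- A function on the plane with an almost period and a symmetry which is a rotation of order at
least three, after adding points, can be made asymmetric. -/
theorem exists_asymmetric_of_almostPeriod {f : ℂ → ℤ} {W : Finset ℂ} (hW : 9 ≤ W.card)
    {v a b : ℂ} (hv0 : v ≠ 0) (hv : IsAlmostPeriod f v) (ha : ‖a‖ = 1) (ha1 : a ≠ 1)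
    (ha2 : a ≠ -1) {S₀ : Finset ℂ} (hinv : IsAffineInvariant (addPoints f S₀) a b) :
    ∃ S ⊆ W, ∀ a b : ℂ, a ≠ 0 → IsAffineInvariant (addPoints f S) a b → a = 1 ∧ b = 0 := by
  have mul_period : ∀ {S : Finset ℂ} {a b : ℂ}, a ≠ 0 → IsAffineInvariant (addPoints f S) a b →
      ∀ u, IsAlmostPeriod f u → IsAlmostPeriod f (a * u) := by
    intro S a b ha hinv u hu
    exact ((hu.congr (addPoints_eventuallyEq f S).symm).mul ha hinv).congr
      (addPoints_eventuallyEq f S)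
  have ha0 : a ≠ 0 := by
    rintro rfl
    simp at ha
  -- A relation gives `m * a = n` with `‖a‖ = 1`, so `a = ±1` unless `m = 0`.
  have hind : ∀ m n : ℤ, m * (a * v) = n * v → m = 0 := by
    intro m n hmn
    have h1 : (m : ℂ) * a = n := mul_right_cancel₀ hv0 (by rw [← hmn]; ring)
    by_contra hm
    have h2 : |m| = |n| := by
      have := congrArg norm h1
      rw [norm_mul, ha, mul_one, Complex.norm_intCast, Complex.norm_intCast] at this
      exact_mod_cast this
    have hmC : (m : ℂ) ≠ 0 := by exact_mod_cast hm
    rcases abs_eq_abs.mp h2 with h | h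
    · exact ha1 (mul_left_cancel₀ hmC (by rw [h1, h, mul_one]))
    · exact ha2 (mul_left_cancel₀ hmC (by rw [h1, h]; push_cast; ring))
  obtain ⟨F, hfF, hF⟩ := exists_periodic_part hv0 hv (mul_period ha0 hinv v hv) hind
  have hfin : (fun z => f z - F z) =ᶠ[cofinite] 0 := by
    filter_upwards [hfF] with z hz
    simp [hz]
  obtain ⟨S, hS, h⟩ := exists_asymmetric_of_finite_support hfin hW
  refine ⟨S, hS, fun a b ha hab => h a b ha ?_⟩
  have hS' : ∀ z, addPoints (fun z => f z - F z) S z = addPoints f S z - F z := fun z => by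
    unfold addPoints; ring
  have hfinS := (addPoints_eventuallyEq (fun z => f z - F z) S).trans hfin
  have hinj : Function.Injective fun z : ℂ => a * z + b := fun x y hxy => by simpa [ha] using hxy
  -- A symmetry of `f + 1_S` also preserves `F`: the difference is finitely supported and has period
  -- `v`. Hence it preserves the finitely supported part.
  have hD : ∀ z, F (a * z + b) - F z = 0 := by
    apply eq_zero_of_period _ hv0
    · intro z
      rw [show a * (z + v) + b = a * z + b + a * v by ring, hF _ (mul_period ha hab v hv), hF _ hv]
    · filter_upwards [hfinS, hinj.tendsto_cofinite.eventually hfinS] with z h1 h2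
      rw [hS', hab] at h2
      rw [hS'] at h1
      simp only [Pi.zero_apply] at *
      omega
  intro z
  rw [hS', hS', hab, sub_eq_zero.mp (hD z)]

/-- Two one-point modifications of a function on the plane whose symmetries are nontrivial, one of
them of order at least three, force a nonzero almost period. -/
theorem exists_almostPeriod {f : ℂ → ℤ} {S : Finset ℂ} {a b t a' b' : ℂ} (ha : a ≠ 0)
    (hinv : IsAffineInvariant (addPoints f S) a b) (ht : a * t + b ≠ t)
    (ha' : a' ≠ 0) (hinv' : IsAffineInvariant (addPoints f (symmDiff S {t})) a' b')
    (hne : ¬ (a' = 1 ∧ b' = 0)) : ∃ v ≠ 0, IsAlmostPeriod f v := by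
  by_contra! hno
  have almost : ∀ {T : Finset ℂ} {a b : ℂ}, IsAffineInvariant (addPoints f T) a b →
      (fun z => f (a * z + b)) =ᶠ[cofinite] f ∨ a = 0 := by
    intro T a b h
    by_cases ha : a = 0
    · exact Or.inr ha
    left
    have hinj : Function.Injective fun z : ℂ => a * z + b := fun x y hxy => by
      simpa [ha] using hxy
    filter_upwards [addPoints_eventuallyEq f T,
      hinj.tendsto_cofinite.eventually (addPoints_eventuallyEq f T)] with z h1 h2
    rw [← h1, ← h2, h]
  have c1 := (almost hinv).resolve_right ha
  have c2 := (almost hinv').resolve_right ha'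
  have hinj : Function.Injective fun z : ℂ => a * z + b := fun x y hxy => by simpa [ha] using hxy
  have hinj' : Function.Injective fun z : ℂ => a' * z + b' := fun x y hxy => by
    simpa [ha'] using hxy
  -- The commutator of the two symmetries is a translation preserving `f` up to finitely many
  -- points, so it must be trivial.
  have hcomm : a * b' + b = a' * b + b' := by
    by_contra hcne
    apply hno (a * b' + b - (a' * b + b')) (sub_ne_zero.mpr hcne)
    have hinj'' : Function.Injective fun z : ℂ => a⁻¹ * a'⁻¹ * (z - (a' * b + b')) :=
      fun x y hxy => by simpa [ha, ha'] using hxy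
    have c3 := hinj'.tendsto_cofinite.eventually c1
    have c4 := hinj.tendsto_cofinite.eventually c2
    have c5 := hinj''.tendsto_cofinite.eventually (c1.and (c2.and (c3.and c4)))
    unfold IsAlmostPeriod
    filter_upwards [c5] with z hz
    obtain ⟨z1, z2, z3, z4⟩ := hz
    have := z3.trans (z2.trans (z1.symm.trans z4.symm))
    rwa [show a * (a' * (a⁻¹ * a'⁻¹ * (z - (a' * b + b'))) + b') + b
        = z + (a * b' + b - (a' * b + b')) by field_simp; ring,
      show a' * (a * (a⁻¹ * a'⁻¹ * (z - (a' * b + b'))) + b) + b' = z by field_simp; ring] at this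
  have ht' : a' * t + b' ≠ t := by
    intro h
    have e : (a' - 1) * (a * t + b - t) = 0 := by
      linear_combination -hcomm + (a - 1) * h
    have ha'1 : a' = 1 := by
      rcases mul_eq_zero.mp e with e | e
      · exact sub_eq_zero.mp e
      · exact absurd (sub_eq_zero.mp e) ht
    subst ha'1
    exact hne ⟨rfl, by linear_combination h⟩
  have g := addPoints_symmDiff f S t
  set ε : ℤ := if t ∈ S then -1 else 1
  have hε : ε = 1 ∨ ε = -1 := by
    by_cases h : t ∈ S <;> simp [ε, h]
  -- With commuting maps this is the parallelogram argument of `isAperiodic_or_of_add_point`.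
  have i1 := hinv' t
  have i2 := hinv' (a * t + b)
  have i3 := hinv t
  have i4 := hinv (a' * t + b')
  rw [show a * (a' * t + b') + b = a' * (a * t + b) + b' by linear_combination hcomm] at i4
  simp only [g, ht, ht', if_true, if_false] at i1 i2
  split_ifs at i2 <;> omega

/-- Any nine points of the plane allow an `SE(2)`-asymmetric extension. -/
theorem exists_affine_asymmetric (f : ℂ → ℤ) {W : Finset ℂ} (hW : 9 ≤ W.card) :
    ∃ S ⊆ W, ∀ a b : ℂ, ‖a‖ = 1 → IsAffineInvariant (addPoints f S) a b → a = 1 ∧ b = 0 := by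
  by_contra! hcon
  have hn0 : ∀ {a : ℂ}, ‖a‖ = 1 → a ≠ 0 := by
    rintro a ha rfl
    simp at ha
  -- `a = 1` is a translation and `a = -1` a reflection `z ↦ b - z` of the group `ℂ`; one orbit
  -- index suffices, and doubling is injective.
  by_cases hpm : ∀ S ⊆ W, ∀ a b : ℂ, ‖a‖ = 1 → IsAffineInvariant (addPoints f S) a b →
      a = 1 ∨ a = -1
  · obtain ⟨V, hV, hV6⟩ := Finset.exists_subset_card_eq (by omega : 6 ≤ W.card)
    refine not_allSymmetric_of_card_eq_six (i := ()) (W := V.map ⟨Prod.mk (), Prod.mk_right_injective _⟩)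
      (fun _ _ => rfl) (by simpa using hV6) ?_ (fun x => f x.2) ?_
    · intro s
      refine (Finset.card_le_one.mpr ?_).trans one_le_two
      rintro ⟨⟨⟩, x⟩ hx ⟨⟨⟩, y⟩ hy
      have h1 : x + x = s := (Finset.mem_filter.mp hx).2
      have h2 : y + y = s := (Finset.mem_filter.mp hy).2
      rw [show x = y by linear_combination (h1 - h2) / 2]
    · intro S hS
      have himg : S.image Prod.snd ⊆ W := by
        intro x hx
        obtain ⟨y, hy, rfl⟩ := Finset.mem_image.mp hx
        obtain ⟨z, hz, rfl⟩ := Finset.mem_map.mp (hS hy)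
        exact hV hz
      have heq : ∀ i x, addPoints (fun x : Unit × ℂ => f x.2) S (i, x)
          = addPoints f (S.image Prod.snd) x := by
        rintro i x
        have : x ∈ S.image Prod.snd ↔ (i, x) ∈ S := by
          rw [Finset.mem_image]
          exact ⟨fun ⟨y, hy, hyx⟩ => by rwa [← hyx], fun h => ⟨_, h, rfl⟩⟩
        simp only [addPoints, this]
      obtain ⟨a, b, ha, hab, hne⟩ := hcon _ himg
      rcases hpm _ himg a b ha hab with rfl | rfl
      · left
        intro hap
        refine hne rfl (hap b fun i x => ?_)
        rw [heq, heq, ← hab x, one_mul]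
      · right
        refine ⟨b, fun i x => ?_⟩
        rw [heq, heq, ← hab x]
        congr 1
        ring
  · push Not at hpm
    obtain ⟨S, hS, a, b, ha, hab, ha1, ha2⟩ := hpm
    obtain ⟨t, ht, htf⟩ : ∃ t ∈ W, a * t + b ≠ t := by
      obtain ⟨x, hx, y, hy, hxy⟩ := Finset.one_lt_card.mp (by omega : 1 < W.card)
      by_contra! h
      have h1 := h x hx
      have h2 := h y hy
      have : (a - 1) * (x - y) = 0 := by linear_combination h1 - h2
      rcases mul_eq_zero.mp this with h | h
      · exact ha1 (sub_eq_zero.mp h)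
      · exact hxy (sub_eq_zero.mp h)
    obtain ⟨a', b', ha', hab', hne⟩ := hcon _ (symmDiff_singleton_subset hS ht)
    obtain ⟨v, hv0, hv⟩ := exists_almostPeriod (hn0 ha) hab htf (hn0 ha') hab'
      (fun h => hne h.1 h.2)
    obtain ⟨T, hT, h⟩ := exists_asymmetric_of_almostPeriod hW hv0 hv ha ha1 ha2 hab
    obtain ⟨a', b', ha', hab', hne⟩ := hcon T hT
    exact hne (h a' b' (hn0 ha') hab').1 (h a' b' (hn0 ha') hab').2

end Affine

/-! ### From integer-valued functions to two-colorings. -/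

section Extension

/-- If all integer valued functions can be made asymmetric by adding points of `W`, then all
two-colorings of the complement of `W` extend to distinguishing ones. -/
theorem exists_distinguishing_extension {Γ X Y : Type*} [Group Γ] [MulAction Γ X] [DecidableEq Y]
    (e : X ≃ Y) {W : Set X}
    (h : ∀ f : Y → ℤ, ∃ S : Finset Y, (S : Set Y) ⊆ e '' W ∧ ∀ γ : Γ,
      (∀ x, addPoints f S (e (γ • x)) = addPoints f S (e x)) → γ = 1)
    (c : ↥(Wᶜ) → Fin 2) :
    ∃ c' : X → Fin 2, (∀ x : ↥(Wᶜ), c' x = c x) ∧ IsDistinguishing Γ c' := by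
  classical
  -- The value `0` on `W` ensures that adding `1` on `S` stays within the two colors.
  let f₀ : X → Fin 2 := fun x => if hx : x ∈ W then 0 else c ⟨x, hx⟩
  obtain ⟨S, hS, hΓ⟩ := h fun y => ((f₀ (e.symm y) : ℕ) : ℤ)
  have hSW : ∀ x, e x ∈ S → x ∈ W := by
    intro x hx
    obtain ⟨x', hx', he⟩ := hS hx
    rwa [← e.injective he]
  let c' : X → Fin 2 := fun x => if e x ∈ S then 1 else f₀ x
  refine ⟨c', ?_, fun γ hγ => hΓ γ fun x => ?_⟩
  · rintro ⟨x, hx⟩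
    have h1 : x ∉ W := hx
    have h2 : e x ∉ S := fun h2 => h1 (hSW x h2)
    simp [c', f₀, h1, h2]
  · have key : ∀ x, addPoints (fun y => ((f₀ (e.symm y) : ℕ) : ℤ)) S (e x) = ((c' x : ℕ) : ℤ) := by
      intro x
      by_cases hx : e x ∈ S
      · have h0 : f₀ x = 0 := by simp [f₀, hSW x hx]
        simp [addPoints, c', hx, h0]
      · simp [addPoints, c', hx]
    rw [key, key, hγ]

theorem distinguishingNumber_eq_two {Γ X : Type*} [Group Γ] [MulAction Γ X] [Nontrivial Γ]
    [Nonempty X] {c : X → Fin 2} (hc : IsDistinguishing Γ c) : distinguishingNumber Γ X = 2 := by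
  have hmem : (2 : ℕ) ∈ {k : ℕ | ∃ c : X → Fin k, IsDistinguishing Γ c} := ⟨c, hc⟩
  refine le_antisymm (Nat.sInf_le hmem) (le_csInf ⟨2, hmem⟩ ?_)
  rintro k ⟨d, hd⟩
  by_contra! hk
  obtain ⟨γ, hγ⟩ := exists_ne (1 : Γ)
  have : Subsingleton (Fin k) := Fin.subsingleton_iff_le_one.mpr (by omega)
  exact hγ (hd γ fun x => Subsingleton.elim _ _)

theorem precoloringExtension_of_distinguishingNumber {Γ X : Type*} [Group Γ] [MulAction Γ X]
    (h2 : distinguishingNumber Γ X = 2) (W : Set X) :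
    PrecoloringExtension Γ W ↔ ∀ c : ↥(Wᶜ) → Fin 2,
      ∃ c' : X → Fin 2, (∀ x : ↥(Wᶜ), c' x = c x) ∧ IsDistinguishing Γ c' := by
  unfold PrecoloringExtension
  rw [h2]

theorem exists_finset_subset_card {X : Type*} {W : Set X} {n : ℕ} (h : (n : ℕ∞) ≤ W.encard) :
    ∃ V : Finset X, (V : Set X) ⊆ W ∧ V.card = n := by
  obtain ⟨V, hV, hn⟩ := Set.exists_subset_encard_eq h
  have hfin : V.Finite := Set.finite_of_encard_eq_coe hn
  refine ⟨hfin.toFinset, by simpa using hV, ?_⟩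
  rw [hfin.encard_eq_coe_toFinset_card] at hn
  exact_mod_cast hn

end Extension

/-! ### Polar coordinates and the upper bound for `O(2)`. -/

section Polar

open ComplexConjugate

/-- Polar coordinates on the punctured plane. -/
noncomputable def polarMap (x : {r : ℝ // 0 < r} × Real.Angle) : ℂ :=
  (x.1 : ℝ) * (x.2.toCircle : ℂ)

theorem toCircle_surjective {u : ℂ} (hu : ‖u‖ = 1) : ∃ θ : Real.Angle, (θ.toCircle : ℂ) = u := by
  refine ⟨(u.arg : Real.Angle), ?_⟩
  rw [Real.Angle.toCircle_coe, Circle.coe_exp]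
  simpa [hu] using Complex.norm_mul_exp_arg_mul_I u

theorem toCircle_injective : Function.Injective fun θ : Real.Angle => (θ.toCircle : ℂ) := by
  intro x y h
  have h' : x.toCircle = y.toCircle := Circle.ext h
  rw [← Real.Angle.arg_toCircle x, ← Real.Angle.arg_toCircle y, h']

theorem norm_polarMap (x : {r : ℝ // 0 < r} × Real.Angle) : ‖polarMap x‖ = x.1 := by
  rw [polarMap, norm_mul, Circle.norm_coe, mul_one, Complex.norm_real, Real.norm_of_nonneg x.1.2.le]

theorem polarMap_injective : Function.Injective polarMap := by
  intro x y h
  have h1 : (x.1 : ℝ) = y.1 := by rw [← norm_polarMap, ← norm_polarMap, h]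
  refine Prod.ext (Subtype.ext h1) (toCircle_injective ?_)
  unfold polarMap at h
  rw [h1] at h
  exact mul_left_cancel₀ (by exact_mod_cast y.1.2.ne') h

theorem exists_polarMap_eq {z : ℂ} (hz : z ≠ 0) : ∃ x, polarMap x = z := by
  obtain ⟨θ, hθ⟩ := toCircle_surjective (u := z / ‖z‖) (by simp [hz])
  refine ⟨(⟨‖z‖, norm_pos_iff.mpr hz⟩, θ), ?_⟩
  have : (‖z‖ : ℂ) ≠ 0 := by simpa using hz
  simp only [polarMap, hθ]
  field_simp

theorem polarMap_add (r : {r : ℝ // 0 < r}) (x p : Real.Angle) :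
    polarMap (r, x + p) = p.toCircle * polarMap (r, x) := by
  simp only [polarMap, Real.Angle.toCircle_add, Circle.coe_mul]
  ring

theorem polarMap_sub (r : {r : ℝ // 0 < r}) (x s : Real.Angle) :
    polarMap (r, s - x) = s.toCircle * conj (polarMap (r, x)) := by
  simp only [polarMap, sub_eq_add_neg, Real.Angle.toCircle_add, Real.Angle.toCircle_neg,
    Circle.coe_mul, Circle.coe_inv_eq_conj, map_mul, Complex.conj_ofReal]
  ring

open scoped Classical in
theorem exists_orthogonal_asymmetric_of_polar (f : ℂ → ℤ)
    {V : Finset ({r : ℝ // 0 < r} × Real.Angle)} (h : ¬ AllSymmetric (f ∘ polarMap) V) :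
    ∃ S : Finset ℂ, S ⊆ V.image polarMap ∧ ∀ u : ℂ, ‖u‖ = 1 →
      ((∀ z, addPoints f S (u * z) = addPoints f S z) → u = 1) ∧
      ¬ ∀ z, addPoints f S (u * conj z) = addPoints f S z := by
  simp only [AllSymmetric, not_forall, not_or, not_not, not_exists] at h
  obtain ⟨S, hS, hap, href⟩ := h
  have key : ∀ x, addPoints f (S.image polarMap) (polarMap x) = addPoints (f ∘ polarMap) S x := by
    intro x
    have : polarMap x ∈ S.image polarMap ↔ x ∈ S := polarMap_injective.mem_finset_image
    simp only [addPoints, this, Function.comp_apply]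
  refine ⟨S.image polarMap, Finset.image_subset_image hS, fun u hu => ⟨fun h => ?_, fun h => ?_⟩⟩
  · obtain ⟨θ, rfl⟩ := toCircle_surjective hu
    have := hap θ fun i x => by rw [← key, ← key, polarMap_add, h]
    simp [this]
  · obtain ⟨θ, rfl⟩ := toCircle_surjective hu
    exact href θ fun i x => by rw [← key, ← key, polarMap_sub, h]

open scoped Classical in
/-- Any seven points of the plane which are not all fixed by one reflection allow an
`O(2)`-asymmetric extension. -/
theorem exists_orthogonal_asymmetric {W : Set ℂ} (hW : 7 ≤ W.encard)
    (hfix : ∀ u : ℂ, ‖u‖ = 1 → ¬ ∀ z ∈ W, u * conj z = z) (f : ℂ → ℤ) :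
    ∃ S : Finset ℂ, (S : Set ℂ) ⊆ W ∧ ∀ u : ℂ, ‖u‖ = 1 →
      ((∀ z, addPoints f S (u * z) = addPoints f S z) → u = 1) ∧
      ¬ ∀ z, addPoints f S (u * conj z) = addPoints f S z := by
  suffices h : ∃ V : Finset ({r : ℝ // 0 < r} × Real.Angle), (∀ x ∈ V, polarMap x ∈ W) ∧
      ¬ AllSymmetric (f ∘ polarMap) V by
    obtain ⟨V, hV, hVs⟩ := h
    obtain ⟨S, hS, h⟩ := exists_orthogonal_asymmetric_of_polar f hVs
    refine ⟨S, fun z hz => ?_, h⟩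
    obtain ⟨x, hx, rfl⟩ := Finset.mem_image.mp (hS hz)
    exact hV x hx
  have h6 : ((6 : ℕ) : ℕ∞) ≤ (polarMap ⁻¹' W).encard := by
    have h1 : W ⊆ insert 0 (polarMap '' (polarMap ⁻¹' W)) := by
      intro z hz
      by_cases hz0 : z = 0
      · exact Or.inl hz0
      · obtain ⟨x, rfl⟩ := exists_polarMap_eq hz0
        exact Or.inr ⟨x, hz, rfl⟩
    have h2 := hW.trans ((Set.encard_le_encard h1).trans (Set.encard_insert_le _ _))
    rw [polarMap_injective.encard_image] at h2
    have h3 : ((6 : ℕ) : ℕ∞) + 1 ≤ (polarMap ⁻¹' W).encard + 1 := by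
      rwa [show ((6 : ℕ) : ℕ∞) + 1 = 7 by norm_num]
    exact (ENat.add_le_add_iff_right ENat.one_ne_top).mp h3
  -- If all doubles agreed, `W` would lie on one line through the origin and be fixed by the
  -- reflection in it.
  obtain ⟨t, ht, u, hu, htu⟩ : ∃ t ∈ polarMap ⁻¹' W, ∃ u ∈ polarMap ⁻¹' W,
      t.2 + t.2 ≠ u.2 + u.2 := by
    by_contra! hall
    obtain ⟨t, ht⟩ : (polarMap ⁻¹' W).Nonempty := by
      rw [← Set.encard_pos]
      exact lt_of_lt_of_le (by norm_num) h6
    refine hfix ((t.2 + t.2).toCircle) (Circle.norm_coe _) fun z hz => ?_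
    by_cases hz0 : z = 0
    · simp [hz0]
    · obtain ⟨x, rfl⟩ := exists_polarMap_eq hz0
      rw [← polarMap_sub, hall t ht x hz, add_sub_cancel_right]
  by_cases hne : t.1 = u.1
  · have hcirc : ∀ x ∈ polarMap ⁻¹' W, ∀ y ∈ polarMap ⁻¹' W, x.2 + x.2 ≠ y.2 + y.2 →
        x.1 ≠ y.1 → ∃ V : Finset ({r : ℝ // 0 < r} × Real.Angle), (∀ x ∈ V, polarMap x ∈ W) ∧
          ¬ AllSymmetric (f ∘ polarMap) V := by
      intro x hx y hy h2 h1
      refine ⟨{x, y}, ?_, not_allSymmetric_of_fst_ne h1 h2 _⟩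
      simp only [Finset.mem_insert, Finset.mem_singleton]
      rintro z (rfl | rfl)
      exacts [hx, hy]
    by_cases hall : ∀ x ∈ polarMap ⁻¹' W, x.1 = t.1
    · obtain ⟨V, hV, hV6⟩ := exists_finset_subset_card h6
      refine ⟨V, fun x hx => hV hx,
        not_allSymmetric_of_card_eq_six (fun x hx => hall x (hV hx)) hV6 ?_ _⟩
      -- Angles with the same double differ by `0` or `π`, so a line through the origin meets the
      -- circle at most twice.
      intro s
      by_contra! h3
      obtain ⟨a, ha, b, hb, c, hc, hab, hac, hbc⟩ := Finset.two_lt_card.mp h3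
      rw [Finset.mem_filter] at ha hb hc
      have two : ∀ x ∈ V, ∀ y ∈ V, x.2 + x.2 = s → y.2 + y.2 = s → x ≠ y →
          x.2 = y.2 + (Real.pi : Real.Angle) := by
        intro x hx y hy hxs hys hxy
        have h := hxs.trans hys.symm
        rw [← two_nsmul, ← two_nsmul, Real.Angle.two_nsmul_eq_iff] at h
        refine h.resolve_left fun h => hxy (Prod.ext ?_ h)
        rw [hall x (hV hx), hall y (hV hy)]
      have e1 := two a ha.1 b hb.1 ha.2 hb.2 hab
      have e2 := two a ha.1 c hc.1 ha.2 hc.2 hac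
      refine hbc (Prod.ext ?_ (add_right_cancel (e1.symm.trans e2)))
      rw [hall b (hV hb.1), hall c (hV hc.1)]
    · push Not at hall
      obtain ⟨x, hx, hxt⟩ := hall
      -- Since `t` and `u` have different doubles, `x` differs from one of them in its double, and
      -- from both in radius.
      by_cases hxd : x.2 + x.2 = t.2 + t.2
      · exact hcirc x hx u hu (hxd ▸ htu) (hne ▸ hxt)
      · exact hcirc x hx t ht hxd hxt
  · refine ⟨{t, u}, ?_, not_allSymmetric_of_fst_ne hne htu _⟩
    simp only [Finset.mem_insert, Finset.mem_singleton]
    rintro z (rfl | rfl)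
    exacts [ht, hu]

end Polar

/-! ### Matrices as complex maps, and transfer to the two groups. -/

section Plane

open ComplexConjugate

/-- The identification of the plane with `ℂ`. -/
def planeEquiv : (Fin 2 → ℝ) ≃ ℂ where
  toFun v := ⟨v 0, v 1⟩
  invFun z := ![z.re, z.im]
  left_inv v := by
    ext i
    fin_cases i <;> rfl
  right_inv z := rfl

@[simp] theorem planeEquiv_re (v : Fin 2 → ℝ) : (planeEquiv v).re = v 0 := rfl

@[simp] theorem planeEquiv_im (v : Fin 2 → ℝ) : (planeEquiv v).im = v 1 := rfl

@[simp] theorem planeEquiv_symm_zero (z : ℂ) : planeEquiv.symm z 0 = z.re := rfl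

@[simp] theorem planeEquiv_symm_one (z : ℂ) : planeEquiv.symm z 1 = z.im := rfl

theorem orthogonal_entries {A : Matrix (Fin 2) (Fin 2) ℝ}
    (hA : A ∈ Matrix.orthogonalGroup (Fin 2) ℝ) :
    A 0 0 ^ 2 + A 0 1 ^ 2 = 1 ∧ A.det ^ 2 = 1 ∧ A 1 1 = A.det * A 0 0 ∧
      A 1 0 = -(A.det * A 0 1) := by
  rw [Matrix.mem_orthogonalGroup_iff] at hA
  have h00 := congrFun (congrFun hA 0) 0
  have h01 := congrFun (congrFun hA 0) 1
  have h11 := congrFun (congrFun hA 1) 1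
  simp only [Matrix.mul_apply, Fin.sum_univ_two, Matrix.transpose_apply,
    Matrix.one_apply_eq, ne_eq, zero_ne_one, not_false_eq_true, Matrix.one_apply_ne] at h00 h01 h11
  rw [Matrix.det_fin_two]
  refine ⟨by linear_combination h00, ?_, ?_, ?_⟩
  · linear_combination A 1 0 ^ 2 * h00 + A 1 1 ^ 2 * h00 + h11
      - (A 0 0 * A 1 0 + A 0 1 * A 1 1) * h01
  · linear_combination -A 1 1 * h00 + A 0 1 * h01
  · linear_combination -A 1 0 * h00 + A 0 0 * h01

theorem planeEquiv_mulVec_of_det_one {A : Matrix (Fin 2) (Fin 2) ℝ}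
    (hA : A ∈ Matrix.orthogonalGroup (Fin 2) ℝ) (hd : A.det = 1) :
    ∃ u : ℂ, ‖u‖ = 1 ∧ ∀ v, planeEquiv (A *ᵥ v) = u * planeEquiv v := by
  obtain ⟨h1, -, h3, h4⟩ := orthogonal_entries hA
  rw [hd, one_mul] at h3 h4
  refine ⟨⟨A 0 0, -A 0 1⟩, ?_, fun v => ?_⟩
  · rw [Complex.norm_def, Complex.normSq_mk, Real.sqrt_eq_one]
    linear_combination h1
  · apply Complex.ext <;> simp [h3, h4, add_comm]

theorem planeEquiv_mulVec_of_det_neg_one {A : Matrix (Fin 2) (Fin 2) ℝ}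
    (hA : A ∈ Matrix.orthogonalGroup (Fin 2) ℝ) (hd : A.det = -1) :
    ∃ u : ℂ, ‖u‖ = 1 ∧ ∀ v, planeEquiv (A *ᵥ v) = u * conj (planeEquiv v) := by
  obtain ⟨h1, -, h3, h4⟩ := orthogonal_entries hA
  rw [hd] at h3 h4
  refine ⟨⟨A 0 0, A 0 1⟩, ?_, fun v => ?_⟩
  · rw [Complex.norm_def, Complex.normSq_mk, Real.sqrt_eq_one]
    linear_combination h1
  · apply Complex.ext <;> simp [h3, h4, add_comm]

theorem planeO2_apply (γ : planeO2) : ∃ u : ℂ, ‖u‖ = 1 ∧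
    ((∀ v : Fin 2 → ℝ, planeEquiv (γ • v) = u * planeEquiv v) ∨
      ∀ v : Fin 2 → ℝ, planeEquiv (γ • v) = u * conj (planeEquiv v)) := by
  obtain ⟨γ, A, hA, hγ⟩ := γ
  have hγ' : ∀ v : Fin 2 → ℝ, (⟨γ, A, hA, hγ⟩ : planeO2) • v = A *ᵥ v := hγ
  simp only [hγ']
  rcases sq_eq_one_iff.mp (orthogonal_entries hA).2.1 with h | h
  · obtain ⟨u, hu, h⟩ := planeEquiv_mulVec_of_det_one hA h
    exact ⟨u, hu, Or.inl h⟩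
  · obtain ⟨u, hu, h⟩ := planeEquiv_mulVec_of_det_neg_one hA h
    exact ⟨u, hu, Or.inr h⟩

theorem planeSE2_apply (γ : planeSE2) : ∃ a b : ℂ, ‖a‖ = 1 ∧
    ∀ v : Fin 2 → ℝ, planeEquiv (γ • v) = a * planeEquiv v + b := by
  obtain ⟨γ, A, hA, b, hγ⟩ := γ
  have hγ' : ∀ v : Fin 2 → ℝ, (⟨γ, A, hA, b, hγ⟩ : planeSE2) • v = A *ᵥ v + b := hγ
  rw [Matrix.mem_specialOrthogonalGroup_iff] at hA
  obtain ⟨u, hu, h⟩ := planeEquiv_mulVec_of_det_one hA.1 hA.2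
  refine ⟨u, planeEquiv b, hu, fun v => ?_⟩
  rw [hγ', ← h]
  rfl

theorem exists_planeO2_reflection {u : ℂ} (hu : ‖u‖ = 1) :
    ∃ γ : planeO2, ∀ v : Fin 2 → ℝ, planeEquiv (γ • v) = u * conj (planeEquiv v) := by
  have huu : u * conj u = 1 := by
    rw [Complex.mul_conj, Complex.normSq_eq_norm_sq, hu]
    norm_num
  have hinv : Function.Involutive fun v => planeEquiv.symm (u * conj (planeEquiv v)) := by
    intro v
    simp only [Equiv.apply_symm_apply, map_mul, Complex.conj_conj, ← mul_assoc, huu, one_mul,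
      Equiv.symm_apply_apply]
  have hsq : u.re * u.re + u.im * u.im = 1 := by
    rw [← Complex.normSq_apply, Complex.normSq_eq_norm_sq, hu, one_pow]
  refine ⟨⟨hinv.toPerm, !![u.re, u.im; u.im, -u.re], ?_, fun v => ?_⟩, fun v => ?_⟩
  · rw [Matrix.mem_orthogonalGroup_iff]
    ext i j
    fin_cases i <;> fin_cases j <;> simp [Matrix.mul_apply, Fin.sum_univ_two] <;> linarith
  · ext i
    fin_cases i
    · simp [Matrix.mulVec, dotProduct, Fin.sum_univ_two]
    · simp [Matrix.mulVec, dotProduct, Fin.sum_univ_two]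
      ring
  · exact planeEquiv.apply_symm_apply _

theorem reflection_ne_one {γ : planeO2} {u : ℂ}
    (h : ∀ v : Fin 2 → ℝ, planeEquiv (γ • v) = u * conj (planeEquiv v)) : γ ≠ 1 := by
  rintro rfl
  have h1 := h (planeEquiv.symm 1)
  have h2 := h (planeEquiv.symm Complex.I)
  simp only [one_smul, Equiv.apply_symm_apply, map_one, mul_one, Complex.conj_I] at h1 h2
  rw [← h1, one_mul, self_eq_neg] at h2
  exact Complex.I_ne_zero h2

instance nontrivial_planeO2 : Nontrivial planeO2 := by
  obtain ⟨γ, hγ⟩ := exists_planeO2_reflection (u := 1) (by simp)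
  exact ⟨γ, 1, reflection_ne_one hγ⟩

instance nontrivial_planeSE2 : Nontrivial planeSE2 := by
  refine ⟨⟨Equiv.addRight 1, 1, one_mem _, 1, fun v => by simp⟩, 1, fun h => ?_⟩
  have := congrArg (fun γ : planeSE2 => (γ : Equiv.Perm (Fin 2 → ℝ)) 0 0) h
  simp at this

theorem eq_one_of_planeEquiv_eq {H : Subgroup (Equiv.Perm (Fin 2 → ℝ))} {γ : H}
    (h : ∀ v : Fin 2 → ℝ, planeEquiv (γ • v) = planeEquiv v) : γ = 1 :=
  Subtype.ext (Equiv.ext fun v => planeEquiv.injective (h v))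

theorem planeO2_exists_extension {W : Set (Fin 2 → ℝ)} (hW : 7 ≤ W.encard)
    (hfix : fixingSubgroup planeO2 W = ⊥) (c : ↥(Wᶜ) → Fin 2) :
    ∃ c' : (Fin 2 → ℝ) → Fin 2, (∀ x : ↥(Wᶜ), c' x = c x) ∧ IsDistinguishing planeO2 c' := by
  classical
  refine exists_distinguishing_extension planeEquiv (fun f => ?_) c
  have hrefl : ∀ u : ℂ, ‖u‖ = 1 → ¬ ∀ z ∈ planeEquiv '' W, u * conj z = z := by
    intro u hu hall
    obtain ⟨γ, hγ⟩ := exists_planeO2_reflection hu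
    have : γ ∈ fixingSubgroup planeO2 W := by
      rw [mem_fixingSubgroup_iff]
      intro v hv
      apply planeEquiv.injective
      rw [hγ, hall _ ⟨v, hv, rfl⟩]
    rw [hfix, Subgroup.mem_bot] at this
    exact reflection_ne_one hγ this
  obtain ⟨S, hS, h⟩ := exists_orthogonal_asymmetric (W := planeEquiv '' W)
    (by rwa [planeEquiv.injective.encard_image]) hrefl f
  refine ⟨S, hS, fun γ hγ => ?_⟩
  obtain ⟨u, hu, hu' | hu'⟩ := planeO2_apply γ
  · have := (h u hu).1 fun z => by
      obtain ⟨v, rfl⟩ := planeEquiv.surjective z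
      rw [← hu', hγ]
    subst this
    exact eq_one_of_planeEquiv_eq fun v => by rw [hu', one_mul]
  · refine absurd (fun z => ?_) (h u hu).2
    obtain ⟨v, rfl⟩ := planeEquiv.surjective z
    rw [← hu', hγ]

theorem planeSE2_exists_extension {W : Set (Fin 2 → ℝ)} (hW : ((9 : ℕ) : ℕ∞) ≤ W.encard)
    (c : ↥(Wᶜ) → Fin 2) :
    ∃ c' : (Fin 2 → ℝ) → Fin 2, (∀ x : ↥(Wᶜ), c' x = c x) ∧ IsDistinguishing planeSE2 c' := by
  refine exists_distinguishing_extension planeEquiv (fun f => ?_) c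
  obtain ⟨V, hV, hV9⟩ := exists_finset_subset_card (W := planeEquiv '' W)
    (by rwa [planeEquiv.injective.encard_image])
  obtain ⟨S, hS, h⟩ := exists_affine_asymmetric f hV9.ge
  refine ⟨S, (Finset.coe_subset.mpr hS).trans hV, fun γ hγ => ?_⟩
  obtain ⟨a, b, ha, hab⟩ := planeSE2_apply γ
  obtain ⟨rfl, rfl⟩ := h a b ha fun z => by
    obtain ⟨v, rfl⟩ := planeEquiv.surjective z
    rw [← hab, hγ]
  exact eq_one_of_planeEquiv_eq fun v => by rw [hab, one_mul, add_zero]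

/-- The extension results are stated for `Fin 2` so that `W = Set.univ` yields a distinguishing
two-coloring before the distinguishing number is known. -/
theorem distinguishingNumber_planeO2 : distinguishingNumber planeO2 (Fin 2 → ℝ) = 2 := by
  obtain ⟨c, -, hc⟩ := planeO2_exists_extension (W := Set.univ) (by simp)
    (by
      rw [eq_bot_iff]
      intro γ hγ
      rw [mem_fixingSubgroup_iff] at hγ
      exact eq_one_of_planeEquiv_eq fun v => by rw [hγ v (Set.mem_univ v)]) fun _ => 0
  exact distinguishingNumber_eq_two hc

theorem distinguishingNumber_planeSE2 : distinguishingNumber planeSE2 (Fin 2 → ℝ) = 2 := by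
  obtain ⟨c, -, hc⟩ := planeSE2_exists_extension (W := Set.univ) (by simp)
    fun _ => 0
  exact distinguishingNumber_eq_two hc

/-! ### The centered pentagon: lower bound for `O(2)`. -/

/-- The vertices of a regular pentagon together with its center. -/
noncomputable def centeredPentagon : Set ℂ :=
  insert 0 (Set.range fun k : ZMod 5 => (ZMod.toCircle k : ℂ))

theorem encard_centeredPentagon : centeredPentagon.encard = 6 := by
  have hinj : Function.Injective fun k : ZMod 5 => (ZMod.toCircle k : ℂ) :=
    Circle.coe_injective.comp ZMod.injective_toCircle
  rw [centeredPentagon, Set.encard_insert_of_notMem, ← Set.image_univ, hinj.encard_image,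
    Set.encard_univ, ENat.card_eq_coe_fintype_card, ZMod.card]
  · norm_num
  · rintro ⟨k, hk⟩
    exact Circle.coe_ne_zero _ hk

theorem toCircle_mul_conj (k x : ZMod 5) :
    (ZMod.toCircle k : ℂ) * conj (ZMod.toCircle x : ℂ) = ZMod.toCircle (k - x) := by
  rw [sub_eq_add_neg, AddChar.map_add_eq_mul, AddChar.map_neg_eq_inv, Circle.coe_mul,
    Circle.coe_inv_eq_conj]

/-- One color is used at most twice, and any set of at most two vertices of the pentagon has a
mirror axis. `ZMod 5` unfolds to `Fin 5`, where the 32 colorings are checked. -/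
theorem exists_pentagon_symmetry : ∀ s : ZMod 5 → Fin 2, ∃ k, ∀ x, s (k - x) = s x := by
  have h : ∀ s : Fin 5 → Fin 2, ∃ k, ∀ x, s (k - x) = s x := by decide
  exact h

theorem fixingSubgroup_centeredPentagon :
    fixingSubgroup planeO2 (planeEquiv.symm '' centeredPentagon) = ⊥ := by
  rw [eq_bot_iff]
  intro γ hγ
  rw [mem_fixingSubgroup_iff] at hγ
  have hk : ∀ k : ZMod 5, γ • planeEquiv.symm (ZMod.toCircle k : ℂ)
      = planeEquiv.symm (ZMod.toCircle k : ℂ) :=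
    fun k => hγ _ ⟨_, Or.inr ⟨k, rfl⟩, rfl⟩
  obtain ⟨u, -, h | h⟩ := planeO2_apply γ
  · have h0 := h (planeEquiv.symm (ZMod.toCircle (0 : ZMod 5) : ℂ))
    rw [hk] at h0
    simp only [AddChar.map_zero_eq_one, Circle.coe_one, Equiv.apply_symm_apply, mul_one] at h0
    subst h0
    exact eq_one_of_planeEquiv_eq fun v => by rw [h, one_mul]
  · have h0 := h (planeEquiv.symm (ZMod.toCircle (0 : ZMod 5) : ℂ))
    have h1 := h (planeEquiv.symm (ZMod.toCircle (1 : ZMod 5) : ℂ))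
    rw [hk, Equiv.apply_symm_apply] at h0 h1
    have hu : u = ZMod.toCircle (0 : ZMod 5) := by
      simpa using h0.symm
    -- A reflection fixing vertex `0` sends vertex `1` to `-1`, and `1 ≠ -1` modulo 5.
    rw [hu, toCircle_mul_conj] at h1
    exact absurd (ZMod.injective_toCircle (Circle.coe_injective h1)) (by decide)

theorem not_precoloringExtension_centeredPentagon :
    ¬ PrecoloringExtension planeO2 (planeEquiv.symm '' centeredPentagon) := by
  rw [precoloringExtension_of_distinguishingNumber distinguishingNumber_planeO2]
  intro h
  obtain ⟨c, hc, hd⟩ := h fun _ => 0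
  obtain ⟨k, hk⟩ := exists_pentagon_symmetry fun x => c (planeEquiv.symm (ZMod.toCircle x : ℂ))
  obtain ⟨γ, hγ⟩ := exists_planeO2_reflection (u := (ZMod.toCircle k : ℂ)) (Circle.norm_coe _)
  refine reflection_ne_one hγ (hd γ fun v => ?_)
  have hγ' : ∀ v : Fin 2 → ℝ,
      γ • v = planeEquiv.symm ((ZMod.toCircle k : ℂ) * conj (planeEquiv v)) := fun v => by
    rw [← hγ, Equiv.symm_apply_apply]
  -- The reflection preserves the pentagon with its coloring and fixes the center; outside, the
  -- coloring is constant.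
  have hmaps : ∀ v : Fin 2 → ℝ, planeEquiv v ∈ centeredPentagon →
      planeEquiv (γ • v) ∈ centeredPentagon ∧ c (γ • v) = c v := by
    rintro v (hv | ⟨x, hx⟩)
    · have hv' : v = planeEquiv.symm 0 := by rw [← hv, Equiv.symm_apply_apply]
      have : γ • v = v := by rw [hγ', hv, map_zero, mul_zero, hv']
      rw [this]
      exact ⟨Or.inl hv, rfl⟩
    · have hv' : v = planeEquiv.symm (ZMod.toCircle x : ℂ) := by
        rw [← Equiv.symm_apply_apply planeEquiv v, ← hx]
      rw [hγ', ← hx]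
      simp only [toCircle_mul_conj, Equiv.apply_symm_apply]
      refine ⟨Or.inr ⟨_, rfl⟩, ?_⟩
      rw [hv']
      exact hk x
  have hinv : γ • γ • v = v := by
    rw [hγ' (γ • v), hγ]
    apply planeEquiv.injective
    rw [Equiv.apply_symm_apply, map_mul, Complex.conj_conj, ← mul_assoc, toCircle_mul_conj]
    simp
  by_cases hv : planeEquiv v ∈ centeredPentagon
  · exact (hmaps v hv).2
  have hv' : planeEquiv (γ • v) ∉ centeredPentagon := by
    intro h
    have := (hmaps _ h).1
    rw [hinv] at this
    exact hv this
  have out : ∀ w : Fin 2 → ℝ, planeEquiv w ∉ centeredPentagon → c w = 0 := by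
    intro w hw
    refine hc ⟨w, ?_⟩
    rintro ⟨z, hz, rfl⟩
    exact hw (by rwa [Equiv.apply_symm_apply])
  rw [out v hv, out _ hv']

end Plane

theorem theorem3 :
    extNumber (Fin 2 → ℝ) planeO2 = 7 ∧ extNumber (Fin 2 → ℝ) planeSE2 < ⊤ := by
  constructor
  · apply le_antisymm
    · refine (iInf₂_le (7 : ℕ) ?_).trans_eq rfl
      intro W hW hfix
      rw [precoloringExtension_of_distinguishingNumber distinguishingNumber_planeO2]
      exact planeO2_exists_extension hW hfix
    · refine le_iInf₂ fun n hn => ?_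
      by_contra! hlt
      have hn6 : n ≤ 6 := by
        have : n < 7 := by exact_mod_cast hlt
        omega
      refine not_precoloringExtension_centeredPentagon
        (hn _ ?_ fixingSubgroup_centeredPentagon)
      rw [planeEquiv.symm.injective.encard_image, encard_centeredPentagon]
      exact_mod_cast hn6
  · refine (iInf₂_le (9 : ℕ) ?_).trans_lt (ENat.natCast_lt_top 9)
    intro W hW _
    rw [precoloringExtension_of_distinguishingNumber distinguishingNumber_planeSE2]
    exact planeSE2_exists_extension hW
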